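/- Use units with $c=G=1$ and signature $(-,+,+,+)$. Let $(\mathcal N,G)$ be a two-dimensional Lorentzian manifold with totally antisymmetric tensor (area form) $\epsilon_{AB}$, i.e. $\epsilon_{01}=\pm\sqrt{-\det G}$ in local coordinates $(x^0,x^1)$, the sign being that of a choice of orientation. Let $r>0$ be a function on $\mathcal N$, and let $\mathcal M=\mathcal N\times S^2$ carry the spherically symmetric metric $$g=G_{AB}(x^C)\,dx^A dx^B+r^2(x^C)\,d\Omega^2 ,$$ where $d\Omega^2$ is the round metric of the unit sphere; $G$, $\epsilon$ and $r$ are of class $C^2$. Let $T_{ab}$ be the energy-momentum tensor defined by the Einstein equation $R_{ab}-\tfrac12 R\,g_{ab}=8\pi T_{ab}$. Let $$K=-(\epsilon^{AB}\partial_B r)\,\partial_A$$ be the Kodama vector. Let $T_{\mathcal N}$ be the restriction of $T$ to $(\mathcal N,G)$, let $\mathcal T_{ab}=(T_{\mathcal N})_{ab}-\tfrac12\operatorname{tr}_G(T_{\mathcal N})\,G_{ab}$ be its trace-free part, and let $\widetilde{\mathcal T}_{ab}=\epsilon_a{}^c\,\mathcal T_{cb}$ be the dual of $\mathcal T$. Let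 $\gamma$ be an affinely parametrized null geodesic of $(\mathcal M,g)$ with tangent $k$, and define its energy by $E=-g(k,K)$. Then $E$ is differentiable along $\gamma$, and at every point of $\gamma$ $$\nabla_k E=-4\pi r\,\widetilde{\mathcal T}(k,k).$$ Equivalently, $$\nabla_k E=-\frac{\delta_k M}{r},\qquad \delta_k M:=4\pi r^2\,T(\bar k,\bar m),$$ where $\bar k$ is the projection of $k$ onto the tangent space of $\mathcal N$ and $\bar m=\epsilon_B{}^A\,\bar k^B\partial_A$ is the dual of $\bar k$. The same two formulas hold for every affinely parametrized timelike geodesic with tangent $\mathfrak u$ and energy $\mathscr E=-g(\mathfrak u,K)$, with $\mathfrak u$ in place of $k$. -/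

import Mathlib

open scoped Manifold ContDiff Matrix

noncomputable section

namespace Redshift

/-! ### Tensor calculus in a chart

`M` is a manifold modelled on `E`, and `b` is a basis of `E`.  In the chart around `p` a point is
described by `x : E`, its coordinates being the components of `x` in the basis `b`. -/

section Chart

variable {ι : Type*} [Fintype ι] [DecidableEq ι]
variable {E : Type*} [NormedAddCommGroup E] [NormedSpace ℝ E]
variable {H : Type*} [TopologicalSpace H] (I : ModelWithCorners ℝ E H)
variable {M : Type*} [TopologicalSpace M] [ChartedSpace H M]

variable (M) in
/-- Covariant 2-tensor fields on `M` (no regularity built in). -/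
abbrev TensorField2 := ∀ p : M, LinearMap.BilinForm ℝ (TangentSpace I p)

variable {I}

/-- The coordinate vector `∂ᵢ` of the chart around `p`, at the point with coordinates `x`. -/
def coordVec (b : Module.Basis ι ℝ E) (p : M) (x : E) (i : ι) :
    TangentSpace I ((extChartAt I p).symm x) :=
  mfderiv 𝓘(ℝ, E) I (extChartAt I p).symm x (b i)

/-- The components `h(∂ᵢ, ∂ⱼ)` of a covariant 2-tensor field in the chart around `p`, as functions
of the coordinates. -/
def comp (b : Module.Basis ι ℝ E) (h : TensorField2 I M) (p : M) (x : E) : Matrix ι ι ℝ :=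
  Matrix.of fun i j => h ((extChartAt I p).symm x) (coordVec b p x i) (coordVec b p x j)

/-- A covariant 2-tensor field is of class `C²`: its components in every preferred chart are. -/
def IsC2 (b : Module.Basis ι ℝ E) (h : TensorField2 I M) : Prop :=
  ∀ (p : M) (i j : ι), ContDiffOn ℝ 2 (fun x => comp b h p x i j) (extChartAt I p).target

/-- The partial derivative `∂ᵢ f`. -/
def pd (b : Module.Basis ι ℝ E) (i : ι) (f : E → ℝ) (x : E) : ℝ := fderiv ℝ f x (b i)

/-- The Christoffel symbols `Γᵏᵢⱼ = ½ gᵏˡ (∂ᵢ gⱼₗ + ∂ⱼ gᵢₗ - ∂ₗ gᵢⱼ)` of a metric with component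
matrix `g`. -/
def christoffel (b : Module.Basis ι ℝ E) (g : E → Matrix ι ι ℝ) (k i j : ι) (x : E) : ℝ :=
  (1 / 2) * ∑ l, (g x)⁻¹ k l *
    (pd b i (fun y => g y j l) x + pd b j (fun y => g y i l) x - pd b l (fun y => g y i j) x)

/-- The Ricci tensor `Rᵢⱼ = ∂ₖ Γᵏᵢⱼ - ∂ⱼ Γᵏₖᵢ + Γᵏₖₗ Γˡᵢⱼ - Γᵏⱼₗ Γˡₖᵢ`. -/
def ricci (b : Module.Basis ι ℝ E) (g : E → Matrix ι ι ℝ) (i j : ι) (x : E) : ℝ :=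
  (∑ k, pd b k (christoffel b g k i j) x) - (∑ k, pd b j (christoffel b g k k i) x)
    + (∑ k, ∑ l, christoffel b g k k l x * christoffel b g l i j x)
    - ∑ k, ∑ l, christoffel b g k j l x * christoffel b g l k i x

/-- The scalar curvature `R = gⁱʲ Rᵢⱼ`. -/
def scalarCurv (b : Module.Basis ι ℝ E) (g : E → Matrix ι ι ℝ) (x : E) : ℝ :=
  ∑ i, ∑ j, (g x)⁻¹ i j * ricci b g i j x

/-- The components `Rᵢⱼ - ½ R gᵢⱼ` of the Einstein tensor. -/
def einsteinComp (b : Module.Basis ι ℝ E) (g : E → Matrix ι ι ℝ) (i j : ι) (x : E) : ℝ :=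
  ricci b g i j x - (1 / 2) * scalarCurv b g x * g x i j

/-- The components of a tangent vector at `p` in the chart around `p`. -/
def vecComp (b : Module.Basis ι ℝ E) (p : M) (v : TangentSpace I p) (i : ι) : ℝ :=
  b.repr (mfderiv I 𝓘(ℝ, E) (extChartAt I p) p v : E) i

/-- The Einstein tensor `Ric - ½ R g` of the metric `g` at `p`, evaluated on two tangent vectors. -/
def einsteinTensor (b : Module.Basis ι ℝ E) (g : TensorField2 I M) (p : M)
    (u v : TangentSpace I p) : ℝ :=
  ∑ i, ∑ j, einsteinComp b (comp b g p) i j (extChartAt I p p) * vecComp b p u i * vecComp b p v j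

/-- The tangent vector of a curve. -/
def velocity (γ : ℝ → M) (s : ℝ) : TangentSpace I (γ s) :=
  mfderiv 𝓘(ℝ, ℝ) I γ s (1 : ℝ)

/-- The coordinates of a curve in the chart around `p`. -/
def curveCoord (I : ModelWithCorners ℝ E H) (b : Module.Basis ι ℝ E) (γ : ℝ → M) (p : M) (k : ι)
    (s : ℝ) : ℝ :=
  b.repr (extChartAt I p (γ s)) k

/-- `γ` is an affinely parametrized geodesic of `g` on the set `J` of parameters: it is of class
`C²` on `J`, and `c''ᵏ + Γᵏᵢⱼ c'ⁱ c'ʲ = 0` at each `s ∈ J`, in the chart around `γ s`. -/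
def IsGeodesicOn (b : Module.Basis ι ℝ E) (g : TensorField2 I M) (γ : ℝ → M) (J : Set ℝ) : Prop :=
  ContMDiffOn 𝓘(ℝ, ℝ) I 2 γ J ∧
    ∀ s ∈ J, ∀ k : ι,
      deriv (deriv (curveCoord I b γ (γ s) k)) s
        + ∑ i, ∑ j, christoffel b (comp b g (γ s)) k i j (extChartAt I (γ s) (γ s))
            * deriv (curveCoord I b γ (γ s) i) s * deriv (curveCoord I b γ (γ s) j) s = 0

/-- A null vector (signature `-+++`). -/
def IsNull (g : TensorField2 I M) {p : M} (v : TangentSpace I p) : Prop :=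
  v ≠ 0 ∧ g p v v = 0

/-- A timelike vector (signature `-+++`). -/
def IsTimelike (g : TensorField2 I M) {p : M} (v : TangentSpace I p) : Prop :=
  g p v v < 0

end Chart

/-! ### The spherically symmetric spacetime `N × S²` -/

/-- The unit sphere in `ℝ³`. -/
abbrev S2 := Metric.sphere (0 : EuclideanSpace ℝ (Fin 3)) 1

/-- The standard basis of `ℝ²`. -/
abbrev basis2 : Module.Basis (Fin 2) ℝ (EuclideanSpace ℝ (Fin 2)) :=
  (EuclideanSpace.basisFun (Fin 2) ℝ).toBasis

/-- The standard basis of `ℝ² × ℝ²`: `Sum.inl A` are the indices along `N`, and `Sum.inr a` those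
along the sphere. -/
abbrev basis4 :
    Module.Basis (Fin 2 ⊕ Fin 2) ℝ (EuclideanSpace ℝ (Fin 2) × EuclideanSpace ℝ (Fin 2)) :=
  basis2.prod basis2

/-- The differential at `x` of the inclusion of the unit sphere in `ℝ³`. -/
def sphereIncl (x : S2) : TangentSpace (𝓡 2) x →ₗ[ℝ] EuclideanSpace ℝ (Fin 3) :=
  (mfderiv (𝓡 2) 𝓘(ℝ, EuclideanSpace ℝ (Fin 3))
    (fun y : S2 => (y : EuclideanSpace ℝ (Fin 3))) x).toLinearMap

/-- The round metric `dΩ²`: the metric that the unit sphere inherits from `ℝ³`. -/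
def roundMetric : TensorField2 (𝓡 2) S2 :=
  fun x => (innerₗ (EuclideanSpace ℝ (Fin 3))).compl₁₂ (sphereIncl x) (sphereIncl x)

section Spacetime

variable {N : Type*} [TopologicalSpace N] [ChartedSpace (EuclideanSpace ℝ (Fin 2)) N]

/-- `G` is a Lorentzian metric of class `C²` (signature `-+`) on the surface `N`. -/
structure IsLorentzMetric (G : TensorField2 (𝓡 2) N) : Prop where
  symm : ∀ q u v, G q u v = G q v u
  frame : ∀ q, ∃ u v, G q u u = -1 ∧ G q v v = 1 ∧ G q u v = 0
  regular : IsC2 basis2 G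

/-- `ε` is an area form of `(N, G)`, that is a totally antisymmetric tensor of class `C²` whose
component `ε₀₁` in any basis is `± √(-det G)`. -/
structure IsAreaForm (G ε : TensorField2 (𝓡 2) N) : Prop where
  alternating : ∀ q u, ε q u u = 0
  normalized : ∀ q u v, ε q u v ^ 2 = -(G q u u * G q v v - G q u v * G q v u)
  regular : IsC2 basis2 ε

/-- The differential of a real-valued function `f` on `N`, at `q`. -/
def dfun (f : N → ℝ) (q : N) : TangentSpace (𝓡 2) q → ℝ :=
  fun v => mfderiv (𝓡 2) 𝓘(ℝ, ℝ) f q v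

/-- The coordinate basis `∂_A` of the tangent space of `N` at `q`, for the preferred chart around
`q`: this chart is what identifies the tangent space with `ℝ²`. -/
def tbasis (q : N) : Module.Basis (Fin 2) ℝ (TangentSpace (𝓡 2) q) := basis2

/-- The components `h_AB` at `q`. -/
def lower {q : N} (h : LinearMap.BilinForm ℝ (TangentSpace (𝓡 2) q)) : Matrix (Fin 2) (Fin 2) ℝ :=
  Matrix.of fun A B => h (tbasis q A) (tbasis q B)

/-- The inverse metric `G^AB` at `q`. -/
def inv (G : TensorField2 (𝓡 2) N) (q : N) : Matrix (Fin 2) (Fin 2) ℝ := (lower (G q))⁻¹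

/-- `ε^AB = G^AC G^BD ε_CD`. -/
def epsUp (G ε : TensorField2 (𝓡 2) N) (q : N) (A B : Fin 2) : ℝ :=
  ∑ C, ∑ D, inv G q A C * inv G q B D * lower (ε q) C D

/-- `ε_A^B = ε_AC G^CB`. -/
def epsMixed (G ε : TensorField2 (𝓡 2) N) (q : N) (A B : Fin 2) : ℝ :=
  ∑ C, lower (ε q) A C * inv G q C B

/-- The Kodama vector `K = -(ε^AB ∂_B r) ∂_A`, as a vector field on `N`. -/
def kodamaN (G ε : TensorField2 (𝓡 2) N) (r : N → ℝ) (q : N) : TangentSpace (𝓡 2) q :=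
  ∑ A, (-∑ B, epsUp G ε q A B * dfun r q (tbasis q B)) • tbasis q A

/-- The dual `ṽ = ε_B^A v^B ∂_A` of a vector tangent to `N`. -/
def dualVec (G ε : TensorField2 (𝓡 2) N) (q : N) (v : TangentSpace (𝓡 2) q) :
    TangentSpace (𝓡 2) q :=
  ∑ A, (∑ B, epsMixed G ε q B A * (tbasis q).repr v B) • tbasis q A

/-- The projection of a tangent vector of `N × S²` to `N`. -/
def projN (p : N × S2) :
    TangentSpace ((𝓡 2).prod (𝓡 2)) p →ₗ[ℝ] TangentSpace (𝓡 2) p.1 :=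
  LinearMap.fst ℝ (EuclideanSpace ℝ (Fin 2)) (EuclideanSpace ℝ (Fin 2))

/-- The projection of a tangent vector of `N × S²` to the sphere. -/
def projS (p : N × S2) :
    TangentSpace ((𝓡 2).prod (𝓡 2)) p →ₗ[ℝ] TangentSpace (𝓡 2) p.2 :=
  LinearMap.snd ℝ (EuclideanSpace ℝ (Fin 2)) (EuclideanSpace ℝ (Fin 2))

/-- Vectors tangent to `N`, as tangent vectors of `N × S²`. -/
def inclN (p : N × S2) :
    TangentSpace (𝓡 2) p.1 →ₗ[ℝ] TangentSpace ((𝓡 2).prod (𝓡 2)) p :=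
  LinearMap.inl ℝ (EuclideanSpace ℝ (Fin 2)) (EuclideanSpace ℝ (Fin 2))

/-- The spacetime metric `g = G + r² dΩ²` on `N × S²`. -/
def spacetimeMetric (G : TensorField2 (𝓡 2) N) (r : N → ℝ) :
    TensorField2 ((𝓡 2).prod (𝓡 2)) (N × S2) :=
  fun p => (G p.1).compl₁₂ (projN p) (projN p)
    + (r p.1) ^ 2 • (roundMetric p.2).compl₁₂ (projS p) (projS p)

/-- The Kodama vector field on the spacetime. -/
def kodama (G ε : TensorField2 (𝓡 2) N) (r : N → ℝ) (p : N × S2) :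
    TangentSpace ((𝓡 2).prod (𝓡 2)) p :=
  inclN p (kodamaN G ε r p.1)

/-- The energy `E = -g(k, K)` of a vector `k`. -/
def energy (G ε : TensorField2 (𝓡 2) N) (r : N → ℝ) (p : N × S2)
    (k : TangentSpace ((𝓡 2).prod (𝓡 2)) p) : ℝ :=
  -spacetimeMetric G r p k (kodama G ε r p)

/-- The restriction `T_N` of `T` to `N`, at `p`. -/
def restrictN (T : TensorField2 ((𝓡 2).prod (𝓡 2)) (N × S2)) (p : N × S2) :
    LinearMap.BilinForm ℝ (TangentSpace (𝓡 2) p.1) :=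
  (T p).compl₁₂ (inclN p) (inclN p)

/-- The components at `p` of the trace-free part `T_N - ½ tr_G(T_N) G` of the restriction of `T`. -/
def traceFree (G : TensorField2 (𝓡 2) N) (T : TensorField2 ((𝓡 2).prod (𝓡 2)) (N × S2))
    (p : N × S2) (A B : Fin 2) : ℝ :=
  lower (restrictN T p) A B
    - (1 / 2) * (∑ C, ∑ D, inv G p.1 C D * lower (restrictN T p) C D) * lower (G p.1) A B

/-- The dual tensor `T̃_AB = ε_A^C 𝒯_CB` of the trace-free part `𝒯`, evaluated on tangent vectors
of the spacetime (it annihilates the directions along the sphere). -/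
def dualT (G ε : TensorField2 (𝓡 2) N) (T : TensorField2 ((𝓡 2).prod (𝓡 2)) (N × S2))
    (p : N × S2) (u v : TangentSpace ((𝓡 2).prod (𝓡 2)) p) : ℝ :=
  ∑ A, ∑ B, (∑ C, epsMixed G ε p.1 A C * traceFree G T p C B)
    * (tbasis p.1).repr (projN p u) A * (tbasis p.1).repr (projN p v) B

/-- The effective mass flux `δ_k M = 4πr² T(k̄, m̄)`, where `k̄` is the projection of `k` to `N` and
`m̄` is the dual of `k̄`. -/
def massFlux (G ε : TensorField2 (𝓡 2) N) (r : N → ℝ)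
    (T : TensorField2 ((𝓡 2).prod (𝓡 2)) (N × S2)) (p : N × S2)
    (k : TangentSpace ((𝓡 2).prod (𝓡 2)) p) : ℝ :=
  4 * Real.pi * r p.1 ^ 2 * T p (inclN p (projN p k)) (inclN p (dualVec G ε p.1 (projN p k)))

end Spacetime

end Redshift

end

/-!
Write `v~` for the dual of a vector `v` tangent to `N`; it is characterized by `G(v~, w) = ε(v, w)`.

The energy of a vector `k` with projection `k̄` to `N` is `E = dr(k̄~)`
(`IsLorentzMetric.energy_eq`). The metric `g = G + r² dΩ²` is a warped product, so its Christoffel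
symbols show that the projection to `N` of a geodesic has acceleration `σ ∇r`, where `σ` is `r` times
the squared norm of the velocity along the unit sphere (`IsWarpedOn.christoffel_base_fibre`). Since
`ε` is parallel (`pd_areaForm`), the derivative of `dr(k̄~)` is
`∇∇r(k̄, k̄~) + σ ε(∇r, ∇r) = ∇∇r(k̄, k̄~)` (`hasDerivAt_dual_grad`, `hasDerivAt_energy`).

On vectors tangent to `N`, the Ricci tensor of the warped product is `Ric_G - (2/r) ∇∇r`
(`IsWarpedOn.ricci_base`; the curvature of the sphere does not enter), and `Ric_G` is a multiple of
`G` because `N` has dimension two (`exists_ricci_eq_mul`). As `G(k̄, k̄~) = ε(k̄, k̄) = 0`, the Einstein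
equation reads `8π T(k̄, k̄~) = -(2/r) ∇∇r(k̄, k̄~)` (`einsteinTensor_inclN`), so the derivative of the
energy is `-4π r T(k̄, k̄~)`. For the same reason `T̃(k, k) = T(k̄~, k̄)`
(`IsLorentzMetric.dualT_eq`), and `T(k̄~, k̄) = T(k̄, k̄~)` by the symmetry of the Hessian.

The tensors are handled through their components in the preferred charts, so the local part of the
argument is stated for matrix-valued functions on normed spaces.
-/

noncomputable section

namespace Redshift

open Filter Topology

/-! ### Partial derivatives in a chart -/

section Coordinates

variable {ι : Type*} {E : Type*} [NormedAddCommGroup E] [NormedSpace ℝ E]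
variable (b : Module.Basis ι ℝ E)

lemma pd_congr {f f' : E → ℝ} {x : E} (h : f =ᶠ[𝓝 x] f') (i : ι) : pd b i f x = pd b i f' x := by
  rw [pd, pd, h.fderiv_eq]

@[simp] lemma pd_const (c : ℝ) (i : ι) (x : E) : pd b i (fun _ => c) x = 0 := by
  simp [pd]

lemma pd_add {f f' : E → ℝ} {x : E} (hf : DifferentiableAt ℝ f x) (hf' : DifferentiableAt ℝ f' x)
    (i : ι) : pd b i (fun y => f y + f' y) x = pd b i f x + pd b i f' x := by
  simp [pd, fderiv_fun_add hf hf']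

lemma pd_sub {f f' : E → ℝ} {x : E} (hf : DifferentiableAt ℝ f x) (hf' : DifferentiableAt ℝ f' x)
    (i : ι) : pd b i (fun y => f y - f' y) x = pd b i f x - pd b i f' x := by
  simp [pd, fderiv_fun_sub hf hf']

lemma pd_mul {f f' : E → ℝ} {x : E} (hf : DifferentiableAt ℝ f x) (hf' : DifferentiableAt ℝ f' x)
    (i : ι) : pd b i (fun y => f y * f' y) x = pd b i f x * f' x + f x * pd b i f' x := by
  simp [pd, fderiv_fun_mul hf hf']; ring

lemma pd_sum {α : Type*} (s : Finset α) {f : α → E → ℝ} {x : E}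
    (hf : ∀ a ∈ s, DifferentiableAt ℝ (f a) x) (i : ι) :
    pd b i (fun y => ∑ a ∈ s, f a y) x = ∑ a ∈ s, pd b i (f a) x := by
  simp [pd, fderiv_fun_sum hf]

/-- Partial derivatives of a `C²` function are differentiable. -/
lemma differentiableAt_pd {f : E → ℝ} {x : E} (hf : ContDiffAt ℝ 2 f x) (i : ι) :
    DifferentiableAt ℝ (pd b i f) x := by
  have h : ContDiffAt ℝ 1 (fderiv ℝ f) x := hf.fderiv_right (by norm_num)
  exact (h.differentiableAt (by norm_num)).clm_apply (differentiableAt_const _)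

lemma pd_pd_comm {f : E → ℝ} {x : E} (hf : ContDiffAt ℝ 2 f x) (i j : ι) :
    pd b i (pd b j f) x = pd b j (pd b i f) x := by
  have h : DifferentiableAt ℝ (fderiv ℝ f) x :=
    (hf.fderiv_right (m := 1) (by norm_num)).differentiableAt (by norm_num)
  have key : ∀ i j, pd b i (pd b j f) x = fderiv ℝ (fderiv ℝ f) x (b i) (b j) := by
    intro i j
    unfold pd
    rw [fderiv_clm_apply h (differentiableAt_const _)]
    simp
  rw [key, key]
  exact hf.isSymmSndFDerivAt (by simp) _ _

/-- `∂ₘ gᵏˡ = - gᵏᵃ (∂ₘ gₐᵦ) gᵇˡ`. -/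
lemma pd_inv [Fintype ι] [DecidableEq ι] {g : E → Matrix ι ι ℝ} {x : E}
    (hg : ∀ i j, DifferentiableAt ℝ (fun y => g y i j) x)
    (hinv : ∀ i j, DifferentiableAt ℝ (fun y => (g y)⁻¹ i j) x)
    (hdet : ∀ᶠ y in 𝓝 x, (g y).det ≠ 0) (m k l : ι) :
    pd b m (fun y => (g y)⁻¹ k l) x
      = -∑ i, ∑ j, (g x)⁻¹ k i * pd b m (fun y => g y i j) x * (g x)⁻¹ j l := by
  have hunit : IsUnit (g x).det := isUnit_iff_ne_zero.2 hdet.self_of_nhds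
  have h1 : ∀ j, ∑ a, pd b m (fun y => (g y)⁻¹ k a) x * g x a j
      = -∑ a, (g x)⁻¹ k a * pd b m (fun y => g y a j) x := by
    intro j
    have : pd b m (fun y => ∑ a, (g y)⁻¹ k a * g y a j) x = 0 := by
      rw [pd_congr b (f' := fun _ => (1 : Matrix ι ι ℝ) k j), pd_const]
      filter_upwards [hdet] with y hy
      rw [← Matrix.nonsing_inv_mul (g y) (isUnit_iff_ne_zero.2 hy), Matrix.mul_apply]
    rw [pd_sum b _ fun a _ => (hinv k a).fun_mul (hg a j),
      Finset.sum_congr rfl fun a _ => pd_mul b (hinv k a) (hg a j) m,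
      Finset.sum_add_distrib] at this
    linarith
  have h2 : ∀ a, ∑ j, g x a j * (g x)⁻¹ j l = (1 : Matrix ι ι ℝ) a l := by
    intro a
    rw [← Matrix.mul_nonsing_inv (g x) hunit, Matrix.mul_apply]
  calc pd b m (fun y => (g y)⁻¹ k l) x
      = ∑ a, pd b m (fun y => (g y)⁻¹ k a) x * (1 : Matrix ι ι ℝ) a l := by
        simp [Matrix.one_apply]
    _ = ∑ j, (∑ a, pd b m (fun y => (g y)⁻¹ k a) x * g x a j) * (g x)⁻¹ j l := by
        simp_rw [← h2, Finset.mul_sum, Finset.sum_mul, mul_assoc]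
        exact Finset.sum_comm
    _ = -∑ i, ∑ j, (g x)⁻¹ k i * pd b m (fun y => g y i j) x * (g x)⁻¹ j l := by
        simp_rw [h1, neg_mul, Finset.sum_neg_distrib, Finset.sum_mul]
        rw [Finset.sum_comm]

end Coordinates

/-! ### The Ricci tensor of a two-dimensional metric -/

section Surface

variable {E : Type*} [NormedAddCommGroup E] [NormedSpace ℝ E]
variable (b : Module.Basis (Fin 2) ℝ E) {g : E → Matrix (Fin 2) (Fin 2) ℝ} {x : E}

lemma contDiffAt_det {n : ℕ∞ω} (hg : ∀ i j, ContDiffAt ℝ n (fun y => g y i j) x) :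
    ContDiffAt ℝ n (fun y => (g y).det) x := by
  simp_rw [Matrix.det_fin_two]
  exact ((hg 0 0).mul (hg 1 1)).sub ((hg 0 1).mul (hg 1 0))

lemma contDiffAt_inv {n : ℕ∞ω} (hg : ∀ i j, ContDiffAt ℝ n (fun y => g y i j) x)
    (hdet : (g x).det ≠ 0) (k l : Fin 2) : ContDiffAt ℝ n (fun y => (g y)⁻¹ k l) x := by
  have hD := (contDiffAt_det hg).inv hdet
  simp_rw [Matrix.inv_def, Ring.inverse_eq_inv', Matrix.smul_apply, Matrix.adjugate_fin_two]
  fin_cases k <;> fin_cases l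
  exacts [hD.mul (hg 1 1), hD.mul (hg 0 1).neg, hD.mul (hg 1 0).neg, hD.mul (hg 0 0)]

lemma inv_fin_two (A : Matrix (Fin 2) (Fin 2) ℝ) :
    A⁻¹ 0 0 = A.det⁻¹ * A 1 1 ∧ A⁻¹ 0 1 = -(A.det⁻¹ * A 0 1) ∧
      A⁻¹ 1 0 = -(A.det⁻¹ * A 1 0) ∧ A⁻¹ 1 1 = A.det⁻¹ * A 0 0 := by
  simp [Matrix.inv_def, Ring.inverse_eq_inv', Matrix.adjugate_fin_two]

lemma eventually_det_ne_zero (hg : ∀ i j, ContDiffAt ℝ 2 (fun y => g y i j) x)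
    (hdet : (g x).det ≠ 0) : ∀ᶠ y in 𝓝 x, (g y).det ≠ 0 :=
  (contDiffAt_det hg).continuousAt.eventually_ne hdet

/-- The Ricci tensor of a two-dimensional metric is pure trace. After the derivatives of `Γ` are
expanded, the relations that make `Rᵢⱼ` proportional to the adjugate of `gⁱʲ` are polynomial
identities in `gⁱʲ` and the first and second derivatives of `gᵢⱼ`. -/
theorem exists_ricci_eq_mul (hg : ∀ i j, ContDiffAt ℝ 2 (fun y => g y i j) x)
    (hsymm : ∀ᶠ y in 𝓝 x, ∀ i j, g y i j = g y j i) (hdet : (g x).det ≠ 0) :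
    ∃ c, ∀ i j, ricci b g i j x = c * g x i j := by
  have hgd : ∀ i j, DifferentiableAt ℝ (fun y => g y i j) x := fun i j =>
    (hg i j).differentiableAt (by norm_num)
  have hid : ∀ i j, DifferentiableAt ℝ (fun y => (g y)⁻¹ i j) x := fun i j =>
    (contDiffAt_inv hg hdet i j).differentiableAt (by norm_num)
  have hpd : ∀ i j k, DifferentiableAt ℝ (fun y => pd b i (fun y => g y j k) y) x := fun i j k =>
    differentiableAt_pd b (hg j k) i
  have hev := eventually_det_ne_zero hg hdet
  have hΓ : ∀ m k i j, pd b m (christoffel b g k i j) x = (1 / 2) * ∑ l,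
      ((-∑ a, ∑ c, (g x)⁻¹ k a * pd b m (fun y => g y a c) x * (g x)⁻¹ c l) *
        (pd b i (fun y => g y j l) x + pd b j (fun y => g y i l) x - pd b l (fun y => g y i j) x)
      + (g x)⁻¹ k l * (pd b m (pd b i (fun y => g y j l)) x + pd b m (pd b j (fun y => g y i l)) x
        - pd b m (pd b l (fun y => g y i j)) x)) := by
    intro m k i j
    have hF : ∀ l, DifferentiableAt ℝ (fun x => pd b i (fun y => g y j l) x
        + pd b j (fun y => g y i l) x - pd b l (fun y => g y i j) x) x := fun l =>
      ((hpd i j l).fun_add (hpd j i l)).fun_sub (hpd l i j)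
    unfold christoffel
    rw [pd_mul b (differentiableAt_const _)
      (DifferentiableAt.fun_sum fun l _ => (hid k l).fun_mul (hF l)), pd_const, zero_mul, zero_add,
      pd_sum b _ fun l _ => (hid k l).fun_mul (hF l)]
    congr 1
    refine Finset.sum_congr rfl fun l _ => ?_
    rw [pd_mul b (hid k l) (hF l), pd_inv b hgd hid hev, pd_sub b ((hpd i j l).fun_add (hpd j i l))
      (hpd l i j), pd_add b (hpd i j l) (hpd j i l)]
  have hs : (fun y => g y 1 0) =ᶠ[𝓝 x] fun y => g y 0 1 := hsymm.mono fun y hy => hy 1 0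
  have hs1 : ∀ m, pd b m (fun y => g y 1 0) =ᶠ[𝓝 x] pd b m (fun y => g y 0 1) := fun m =>
    hs.eventuallyEq_nhds.mono fun y hy => pd_congr b hy m
  have hs1' : ∀ m, pd b m (fun y => g y 1 0) x = pd b m (fun y => g y 0 1) x := fun m =>
    (hs1 m).self_of_nhds
  have hs2 : ∀ n m, pd b n (pd b m (fun y => g y 1 0)) x = pd b n (pd b m (fun y => g y 0 1)) x :=
    fun n m => pd_congr b (hs1 m) n
  have hcomm : ∀ i j, pd b 1 (pd b 0 (fun y => g y i j)) x = pd b 0 (pd b 1 (fun y => g y i j)) x :=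
    fun i j => pd_pd_comm b (hg i j) 1 0
  obtain ⟨h00, h01, h10, h11⟩ := inv_fin_two (g x)
  have hi : (g x)⁻¹ 1 0 = (g x)⁻¹ 0 1 := by rw [h10, h01, hsymm.self_of_nhds 1 0]
  have R : ∀ i j, ricci b g i j x = _ := fun i j => by
    unfold ricci
    simp only [hΓ]
    unfold christoffel
    rfl
  -- `e1` to `e4` say that `Rᵢⱼ` is proportional to `(g¹¹, -g⁰¹, g⁰⁰)`, without division.
  have e1 : ricci b g 1 0 x = ricci b g 0 1 x := by
    simp only [R, Fin.sum_univ_two, hs1', hs2, hcomm, hi]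
    ring
  have e2 : ricci b g 0 0 x * (g x)⁻¹ 0 0 = ricci b g 1 1 x * (g x)⁻¹ 1 1 := by
    simp only [R, Fin.sum_univ_two, hs1', hs2, hcomm, hi]
    ring
  have e3 : ricci b g 0 0 x * (g x)⁻¹ 0 1 = -(ricci b g 0 1 x * (g x)⁻¹ 1 1) := by
    simp only [R, Fin.sum_univ_two, hs1', hs2, hcomm, hi]
    ring
  have e4 : ricci b g 1 1 x * (g x)⁻¹ 0 1 = -(ricci b g 0 1 x * (g x)⁻¹ 0 0) := by
    simp only [R, Fin.sum_univ_two, hs1', hs2, hcomm, hi]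
    ring
  set D := (g x).det with hD
  have hDe : D = g x 0 0 * g x 1 1 - g x 0 1 * g x 0 1 := by
    rw [hD, Matrix.det_fin_two, hsymm.self_of_nhds 1 0]
  have g00 : g x 0 0 = D * (g x)⁻¹ 1 1 := by rw [h11]; field_simp
  have g11 : g x 1 1 = D * (g x)⁻¹ 0 0 := by rw [h00]; field_simp
  have g01 : g x 0 1 = -(D * (g x)⁻¹ 0 1) := by rw [h01]; field_simp
  have hDh : D * ((g x)⁻¹ 0 0 * (g x)⁻¹ 1 1 - (g x)⁻¹ 0 1 * (g x)⁻¹ 0 1) = 1 := by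
    apply mul_left_cancel₀ hdet
    linear_combination -hDe - g x 1 1 * g00 - D * (g x)⁻¹ 1 1 * g11
      + (g x 0 1 - D * (g x)⁻¹ 0 1) * g01
  -- The factor is half the scalar curvature `gⁱʲ Rᵢⱼ`.
  refine ⟨(1 / 2) * ((g x)⁻¹ 0 0 * ricci b g 0 0 x + 2 * (g x)⁻¹ 0 1 * ricci b g 0 1 x
    + (g x)⁻¹ 1 1 * ricci b g 1 1 x), ?_⟩
  intro i j
  have r01 : ricci b g 0 1 x = (1 / 2) * ((g x)⁻¹ 0 0 * ricci b g 0 0 x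
      + 2 * (g x)⁻¹ 0 1 * ricci b g 0 1 x + (g x)⁻¹ 1 1 * ricci b g 1 1 x) * g x 0 1 := by
    rw [g01]
    linear_combination -ricci b g 0 1 x * hDh + (1 / 2) * D * (g x)⁻¹ 0 0 * e3
      + (1 / 2) * D * (g x)⁻¹ 1 1 * e4
  fin_cases i <;> fin_cases j <;> simp only [Fin.zero_eta, Fin.mk_one]
  · rw [g00]
    linear_combination -ricci b g 0 0 x * hDh + (1 / 2) * D * (g x)⁻¹ 1 1 * e2
      - D * (g x)⁻¹ 0 1 * e3
  · exact r01
  · rw [e1, hsymm.self_of_nhds 1 0]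
    exact r01
  · rw [g11]
    linear_combination -ricci b g 1 1 x * hDh - (1 / 2) * D * (g x)⁻¹ 0 0 * e2
      - D * (g x)⁻¹ 0 1 * e4

end Surface

/-! ### The Hessian of a function -/

section Hessian

variable {ι : Type*} [Fintype ι] [DecidableEq ι]
variable {E : Type*} [NormedAddCommGroup E] [NormedSpace ℝ E]

/-- The components `∇ᵢ∇ⱼ f = ∂ᵢ∂ⱼ f - Γᵏᵢⱼ ∂ₖ f` of the Hessian of a function. -/
def hess (b : Module.Basis ι ℝ E) (g : E → Matrix ι ι ℝ) (f : E → ℝ) (i j : ι) (x : E) : ℝ :=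
  pd b i (pd b j f) x - ∑ k, christoffel b g k i j x * pd b k f x

lemma hess_symm (b : Module.Basis ι ℝ E) {g : E → Matrix ι ι ℝ} {f : E → ℝ} {x : E}
    (hsymm : ∀ᶠ y in 𝓝 x, ∀ i j, g y i j = g y j i) (hf : ContDiffAt ℝ 2 f x) (i j : ι) :
    hess b g f i j x = hess b g f j i x := by
  have hΓ : ∀ k, christoffel b g k i j x = christoffel b g k j i x := fun k => by
    have h : ∀ l, pd b l (fun y => g y i j) x = pd b l (fun y => g y j i) x := fun l =>
      pd_congr b (hsymm.mono fun y hy => hy i j) l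
    simp only [christoffel, h]
    congr 1
    exact Finset.sum_congr rfl fun l _ => by ring
  simp only [hess, pd_pd_comm b hf i j, hΓ]

omit [DecidableEq ι] in
/-- The chain rule `(f ∘ X)' = Vⁱ ∂ᵢ f` along a curve with velocity `V`. -/
lemma hasDerivAt_comp_path (b : Module.Basis ι ℝ E) {f : E → ℝ} {X : ℝ → E} {V : ι → ℝ} {s : ℝ}
    (hf : DifferentiableAt ℝ f (X s)) (hX : HasDerivAt X (∑ i, V i • b i) s) :
    HasDerivAt (fun t => f (X t)) (∑ i, V i * pd b i f (X s)) s := by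
  have := hf.hasFDerivAt.comp_hasDerivAt s hX
  simpa [pd, Function.comp_def] using this

end Hessian

/-! ### Parallel dual of the velocity of a curve on a surface -/

section EnergyInCoordinates

variable {E : Type*} [NormedAddCommGroup E] [NormedSpace ℝ E]
variable (b : Module.Basis (Fin 2) ℝ E) {g ε : E → Matrix (Fin 2) (Fin 2) ℝ} {ρ : E → ℝ}

/-- `∇ε = 0` for an area form: the derivative of `ε₀₁² = -det g` gives `∂ₘ ε₀₁ = ½ ε₀₁ gⁱʲ ∂ₘ gᵢⱼ`,
that is `∂ₘ ε₀₁ = Γᵏₖₘ ε₀₁`. -/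
lemma pd_areaForm {x : E} (hg : ∀ i j, DifferentiableAt ℝ (fun y => g y i j) x)
    (hsymm : ∀ᶠ y in 𝓝 x, ∀ i j, g y i j = g y j i) (hdet : (g x).det ≠ 0)
    (hε : DifferentiableAt ℝ (fun y => ε y 0 1) x)
    (hεg : ∀ᶠ y in 𝓝 x, ε y 0 1 ^ 2 = -(g y).det) (m : Fin 2) :
    pd b m (fun y => ε y 0 1) x
      = (1 / 2) * ε x 0 1 * ∑ i, ∑ j, (g x)⁻¹ i j * pd b m (fun y => g y i j) x := by
  have h1 : pd b m (fun y => ε y 0 1 * ε y 0 1) x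
      = pd b m (fun y => g y 0 1 * g y 1 0 - g y 0 0 * g y 1 1) x := by
    refine pd_congr b (hεg.mono fun y hy => ?_) m
    rw [← pow_two, hy, Matrix.det_fin_two]
    ring
  rw [pd_mul b hε hε, pd_sub b ((hg _ _).fun_mul (hg _ _)) ((hg _ _).fun_mul (hg _ _)),
    pd_mul b (hg _ _) (hg _ _), pd_mul b (hg _ _) (hg _ _)] at h1
  have hs : pd b m (fun y => g y 1 0) x = pd b m (fun y => g y 0 1) x :=
    pd_congr b (hsymm.mono fun y hy => hy 1 0) m
  have h2 := hεg.self_of_nhds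
  have hne : ε x 0 1 ≠ 0 := by
    intro h
    rw [h] at h2
    apply hdet
    linarith
  obtain ⟨h00, h01, h10, h11⟩ := inv_fin_two (g x)
  rw [Fin.sum_univ_two, Fin.sum_univ_two, Fin.sum_univ_two, h00, h01, h10, h11, hs,
    hsymm.self_of_nhds 1 0]
  rw [hs, hsymm.self_of_nhds 1 0] at h1
  apply mul_left_cancel₀ hne
  have h3 : ∀ z, ε x 0 1 * ε x 0 1 * ((g x).det⁻¹ * z) = -z := by
    intro z
    rw [← pow_two, h2]
    field_simp
  linear_combination (1 / 2) * h1 - (1 / 2) * pd b m (fun y => g y 0 0) x * h3 (g x 1 1)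
    - (1 / 2) * pd b m (fun y => g y 1 1) x * h3 (g x 0 0)
    + pd b m (fun y => g y 0 1) x * h3 (g x 0 1)

/-- Along a curve with acceleration `∇_V V = σ ∇ρ`, the quantity `dρ(V~)`, for `V~` the dual of the
velocity `V`, has derivative `∇∇ρ(V, V~)`: the dual is parallel, and the acceleration contributes
`σ dρ((∇ρ)~) = σ ε(∇ρ, ∇ρ) = 0`. -/
theorem hasDerivAt_dual_grad {X : ℝ → E} {V : Fin 2 → ℝ → ℝ} {a : Fin 2 → ℝ} {s σ : ℝ}
    (hg : ∀ i j, ContDiffAt ℝ 2 (fun y => g y i j) (X s))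
    (hsymm : ∀ᶠ y in 𝓝 (X s), ∀ i j, g y i j = g y j i) (hdet : (g (X s)).det ≠ 0)
    (hε : ∀ i j, DifferentiableAt ℝ (fun y => ε y i j) (X s))
    (halt : ∀ᶠ y in 𝓝 (X s), ∀ i j, ε y i j = -ε y j i)
    (hεg : ∀ᶠ y in 𝓝 (X s), ε y 0 1 ^ 2 = -(g y).det)
    (hρ : ContDiffAt ℝ 2 ρ (X s))
    (hX : HasDerivAt X (∑ i, V i s • b i) s) (hV : ∀ k, HasDerivAt (V k) (a k) s)
    (ha : ∀ k, a k + ∑ i, ∑ j, christoffel b g k i j (X s) * V i s * V j s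
      = σ * ∑ l, (g (X s))⁻¹ k l * pd b l ρ (X s)) :
    HasDerivAt
      (fun t => ∑ i, ∑ j, ∑ k, V i t * ε (X t) i j * (g (X t))⁻¹ j k * pd b k ρ (X t))
      (∑ i, ∑ j, hess b g ρ i j (X s) * V i s * ∑ k, ∑ l, V k s * ε (X s) k l * (g (X s))⁻¹ l j)
      s := by
  have hgd : ∀ i j, DifferentiableAt ℝ (fun y => g y i j) (X s) := fun i j =>
    (hg i j).differentiableAt (by norm_num)
  have hid : ∀ i j, DifferentiableAt ℝ (fun y => (g y)⁻¹ i j) (X s) := fun i j =>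
    (contDiffAt_inv hg hdet i j).differentiableAt (by norm_num)
  have hρd : ∀ k, DifferentiableAt ℝ (pd b k ρ) (X s) := differentiableAt_pd b hρ
  -- The product rule is applied term by term; after `∂g⁻¹`, `∂ε` and the acceleration are expressed
  -- through `g⁻¹`, `∂g` and `∂ρ`, the claim is a polynomial identity.
  have key : HasDerivAt
      (fun t => ∑ i, ∑ j, ∑ k, V i t * ε (X t) i j * (g (X t))⁻¹ j k * pd b k ρ (X t)) _ s :=
    HasDerivAt.fun_sum fun i _ => HasDerivAt.fun_sum fun j _ => HasDerivAt.fun_sum fun k _ =>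
      (((hV i).fun_mul (hasDerivAt_comp_path b (hε i j) hX)).fun_mul
        (hasDerivAt_comp_path b (hid j k) hX)).fun_mul (hasDerivAt_comp_path b (hρd k) hX)
  refine key.congr_deriv ?_
  have hs : ∀ m, pd b m (fun y => g y 1 0) (X s) = pd b m (fun y => g y 0 1) (X s) := fun m =>
    pd_congr b (hsymm.mono fun y hy => hy 1 0) m
  have hε00 : ∀ i, (fun y => ε y i i) =ᶠ[𝓝 (X s)] fun _ => 0 := fun i =>
    halt.mono fun y hy => by linarith [hy i i]
  have hε10 : (fun y => ε y 1 0) =ᶠ[𝓝 (X s)] fun y => 0 - ε y 0 1 :=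
    halt.mono fun y hy => by linarith [hy 1 0]
  have dε00 : ∀ i m, pd b m (fun y => ε y i i) (X s) = 0 := fun i m => by
    rw [pd_congr b (hε00 i), pd_const]
  have dε10 : ∀ m, pd b m (fun y => ε y 1 0) (X s) = -pd b m (fun y => ε y 0 1) (X s) := fun m => by
    rw [pd_congr b hε10, pd_sub b (differentiableAt_const _) (hε 0 1), pd_const, zero_sub]
  have vε00 : ∀ i, ε (X s) i i = 0 := fun i => (hε00 i).self_of_nhds
  have vε10 : ε (X s) 1 0 = -ε (X s) 0 1 := halt.self_of_nhds 1 0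
  have hi : (g (X s))⁻¹ 1 0 = (g (X s))⁻¹ 0 1 := by
    obtain ⟨-, h01, h10, -⟩ := inv_fin_two (g (X s))
    rw [h10, h01, hsymm.self_of_nhds 1 0]
  have ha' : ∀ k, a k = σ * (∑ l, (g (X s))⁻¹ k l * pd b l ρ (X s))
      - ∑ i, ∑ j, christoffel b g k i j (X s) * V i s * V j s := fun k => by linarith [ha k]
  have hc : pd b 1 (pd b 0 ρ) (X s) = pd b 0 (pd b 1 ρ) (X s) := pd_pd_comm b hρ 1 0
  have hp := pd_areaForm b hgd hsymm hdet (hε 0 1) hεg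
  simp only [ha', hess, pd_inv b hgd hid (eventually_det_ne_zero hg hdet), christoffel,
    Fin.sum_univ_two, dε00, dε10, vε00, vε10, hi, hs, hc, hp]
  ring

end EnergyInCoordinates

/-! ### Warped products -/

section Warped

variable {ι κ : Type*} {E F : Type*} [NormedAddCommGroup E] [NormedSpace ℝ E]
  [NormedAddCommGroup F] [NormedSpace ℝ F]
variable (b : Module.Basis ι ℝ E) (b' : Module.Basis κ ℝ F)

/-- No differentiability is assumed: `f ∘ Prod.fst` is differentiable only where `f` is. -/
lemma fderiv_comp_fst (f : E → ℝ) (z : E × F) (v : E × F) :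
    fderiv ℝ (fun z : E × F => f z.1) z v = fderiv ℝ f z.1 v.1 := by
  by_cases hf : DifferentiableAt ℝ f z.1
  · have := hf.hasFDerivAt.comp z (hasFDerivAt_fst (𝕜 := ℝ) (p := z))
    rw [show (fun z : E × F => f z.1) = f ∘ Prod.fst from rfl, this.fderiv]
    rfl
  · have h : ¬ DifferentiableAt ℝ (fun z : E × F => f z.1) z := by
      intro h
      apply hf
      have h2 : DifferentiableAt ℝ (fun x : E => (x, z.2)) z.1 := by fun_prop
      exact DifferentiableAt.comp (g := fun z : E × F => f z.1) z.1 h h2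
    rw [fderiv_zero_of_not_differentiableAt h, fderiv_zero_of_not_differentiableAt hf]
    rfl

lemma pd_inl_comp_fst (f : E → ℝ) (z : E × F) (i : ι) :
    pd (b.prod b') (Sum.inl i) (fun z : E × F => f z.1) z = pd b i f z.1 := by
  rw [pd, fderiv_comp_fst]
  simp [pd]

lemma pd_inr_comp_fst (f : E → ℝ) (z : E × F) (a : κ) :
    pd (b.prod b') (Sum.inr a) (fun z : E × F => f z.1) z = 0 := by
  rw [pd, fderiv_comp_fst]
  simp

lemma pd_inl_comp_snd {f : F → ℝ} {z : E × F} (hf : DifferentiableAt ℝ f z.2) (i : ι) :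
    pd (b.prod b') (Sum.inl i) (fun z : E × F => f z.2) z = 0 := by
  have := hf.hasFDerivAt.comp z (hasFDerivAt_snd (𝕜 := ℝ) (p := z))
  rw [pd, show (fun z : E × F => f z.2) = f ∘ Prod.snd from rfl, this.fderiv]
  simp

variable [Fintype ι] [DecidableEq ι] [Fintype κ] [DecidableEq κ]

/-- On the open set `U` of `E × F` the metric `g` is the warped product `g₁ + ρ² Ω` of a metric
`g₁` on `E` and a metric `Ω` on `F`, given by their component matrices. -/
structure IsWarpedOn (g : E × F → Matrix (ι ⊕ κ) (ι ⊕ κ) ℝ) (g₁ : E → Matrix ι ι ℝ) (ρ : E → ℝ)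
    (Ω : F → Matrix κ κ ℝ) (U : Set (E × F)) : Prop where
  isOpen : IsOpen U
  eq : ∀ z ∈ U, g z = Matrix.fromBlocks (g₁ z.1) 0 0 (ρ z.1 ^ 2 • Ω z.2)
  diff_warp : ∀ z ∈ U, ContDiffAt ℝ 2 ρ z.1
  warp_ne : ∀ z ∈ U, ρ z.1 ≠ 0
  diff_fibre : ∀ z ∈ U, ∀ a c, DifferentiableAt ℝ (fun y => Ω y a c) z.2
  symm_fibre : ∀ z ∈ U, ∀ a c, Ω z.2 a c = Ω z.2 c a
  det_base : ∀ z ∈ U, (g₁ z.1).det ≠ 0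
  det_fibre : ∀ z ∈ U, (Ω z.2).det ≠ 0

namespace IsWarpedOn

variable {b b'}
variable {g : E × F → Matrix (ι ⊕ κ) (ι ⊕ κ) ℝ} {g₁ : E → Matrix ι ι ℝ} {ρ : E → ℝ}
  {Ω : F → Matrix κ κ ℝ} {U : Set (E × F)} (h : IsWarpedOn g g₁ ρ Ω U) {z : E × F} (hz : z ∈ U)
include h hz

lemma eventually_mem : ∀ᶠ w in 𝓝 z, w ∈ U := h.isOpen.mem_nhds hz

lemma inv_eq : (g z)⁻¹ = Matrix.fromBlocks (g₁ z.1)⁻¹ 0 0 ((ρ z.1 ^ 2)⁻¹ • (Ω z.2)⁻¹) := by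
  rw [h.eq z hz]
  apply Matrix.inv_eq_right_inv
  have h1 := Matrix.mul_nonsing_inv (g₁ z.1) (isUnit_iff_ne_zero.2 (h.det_base z hz))
  have h2 := Matrix.mul_nonsing_inv (Ω z.2) (isUnit_iff_ne_zero.2 (h.det_fibre z hz))
  have h3 := pow_ne_zero 2 (h.warp_ne z hz)
  simp [Matrix.fromBlocks_multiply, h1, h2, smul_smul, h3]

lemma pd_inl_base (m i j : ι) : pd (b.prod b') (Sum.inl m) (fun y => g y (Sum.inl i) (Sum.inl j)) z
    = pd b m (fun y => g₁ y i j) z.1 := by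
  rw [← pd_inl_comp_fst b b']
  exact pd_congr _ ((h.eventually_mem hz).mono fun w hw => by simp [h.eq w hw]) _

lemma pd_inr_base (a : κ) (i j : ι) :
    pd (b.prod b') (Sum.inr a) (fun y => g y (Sum.inl i) (Sum.inl j)) z = 0 := by
  rw [← pd_inr_comp_fst b b' (fun y => g₁ y i j) z a]
  exact pd_congr _ ((h.eventually_mem hz).mono fun w hw => by simp [h.eq w hw]) _

lemma pd_mixed (m : ι ⊕ κ) (i : ι) (a : κ) :
    pd (b.prod b') m (fun y => g y (Sum.inl i) (Sum.inr a)) z = 0 := by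
  rw [← pd_const (b.prod b') 0 m z]
  exact pd_congr _ ((h.eventually_mem hz).mono fun w hw => by simp [h.eq w hw]) _

lemma pd_mixed' (m : ι ⊕ κ) (i : ι) (a : κ) :
    pd (b.prod b') m (fun y => g y (Sum.inr a) (Sum.inl i)) z = 0 := by
  rw [← pd_const (b.prod b') 0 m z]
  exact pd_congr _ ((h.eventually_mem hz).mono fun w hw => by simp [h.eq w hw]) _

lemma pd_inl_fibre (i : ι) (a c : κ) :
    pd (b.prod b') (Sum.inl i) (fun y => g y (Sum.inr a) (Sum.inr c)) z
      = 2 * ρ z.1 * pd b i ρ z.1 * Ω z.2 a c := by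
  have hρ : DifferentiableAt ℝ ρ z.1 := (h.diff_warp z hz).differentiableAt (by norm_num)
  have hρ1 : DifferentiableAt ℝ (fun w : E × F => ρ w.1) z := hρ.comp z differentiableAt_fst
  have hΩ : DifferentiableAt ℝ (fun w : E × F => Ω w.2 a c) z :=
    (h.diff_fibre z hz a c).comp z differentiableAt_snd
  rw [pd_congr (b.prod b') (f' := fun w => (ρ w.1 * ρ w.1) * Ω w.2 a c)
    ((h.eventually_mem hz).mono fun w hw => by simp [h.eq w hw, pow_two]),
    pd_mul _ (hρ1.fun_mul hρ1) hΩ, pd_mul _ hρ1 hρ1, pd_inl_comp_fst,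
    pd_inl_comp_snd b b' (f := fun y => Ω y a c) (h.diff_fibre z hz a c)]
  ring

lemma christoffel_base (k i j : ι) :
    christoffel (b.prod b') g (Sum.inl k) (Sum.inl i) (Sum.inl j) z
      = christoffel b g₁ k i j z.1 := by
  simp [christoffel, h.inv_eq hz, h.pd_inl_base hz]

lemma christoffel_base_mixed (k i : ι) (a : κ) :
    christoffel (b.prod b') g (Sum.inl k) (Sum.inl i) (Sum.inr a) z = 0 := by
  simp [christoffel, h.inv_eq hz, h.pd_mixed hz, h.pd_mixed' hz, h.pd_inr_base hz]

lemma christoffel_base_mixed' (k i : ι) (a : κ) :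
    christoffel (b.prod b') g (Sum.inl k) (Sum.inr a) (Sum.inl i) z = 0 := by
  simp [christoffel, h.inv_eq hz, h.pd_mixed hz, h.pd_mixed' hz, h.pd_inr_base hz]

/-- The component that accelerates the projection of a geodesic to the base along `∇ρ`. -/
lemma christoffel_base_fibre (k : ι) (a c : κ) :
    christoffel (b.prod b') g (Sum.inl k) (Sum.inr a) (Sum.inr c) z
      = -(ρ z.1 * Ω z.2 a c * ∑ l, (g₁ z.1)⁻¹ k l * pd b l ρ z.1) := by
  simp only [christoffel, h.inv_eq hz, h.pd_mixed' hz, h.pd_inl_fibre hz, Fintype.sum_sum_type,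
    Matrix.fromBlocks_apply₁₁, Matrix.fromBlocks_apply₁₂, Matrix.zero_apply, zero_mul,
    Finset.sum_const_zero, add_zero, zero_sub, Finset.mul_sum, ← Finset.sum_neg_distrib]
  refine Finset.sum_congr rfl fun l _ => ?_
  ring

lemma christoffel_fibre_base (a : κ) (i j : ι) :
    christoffel (b.prod b') g (Sum.inr a) (Sum.inl i) (Sum.inl j) z = 0 := by
  simp [christoffel, h.inv_eq hz, h.pd_mixed hz, h.pd_inr_base hz]

lemma christoffel_fibre_mixed (a : κ) (i : ι) (c : κ) :
    christoffel (b.prod b') g (Sum.inr a) (Sum.inl i) (Sum.inr c) z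
      = if a = c then pd b i ρ z.1 / ρ z.1 else 0 := by
  have hΩ : ∑ l, (Ω z.2)⁻¹ a l * Ω z.2 c l = (1 : Matrix κ κ ℝ) a c := by
    rw [← Matrix.nonsing_inv_mul (Ω z.2) (isUnit_iff_ne_zero.2 (h.det_fibre z hz)),
      Matrix.mul_apply]
    exact Finset.sum_congr rfl fun l _ => by rw [h.symm_fibre z hz]
  have hρ := h.warp_ne z hz
  trans pd b i ρ z.1 / ρ z.1 * (1 : Matrix κ κ ℝ) a c
  · rw [← hΩ]
    simp only [christoffel, h.inv_eq hz, h.pd_mixed hz, h.pd_inl_fibre hz, Fintype.sum_sum_type,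
      Matrix.fromBlocks_apply₂₁, Matrix.fromBlocks_apply₂₂, Matrix.zero_apply, zero_mul,
      Finset.sum_const_zero, add_zero, zero_add, sub_zero, Finset.mul_sum, Matrix.smul_apply,
      smul_eq_mul]
    refine Finset.sum_congr rfl fun l _ => ?_
    field_simp
  · simp [Matrix.one_apply]

lemma christoffel_fibre_mixed' (a : κ) (i : ι) (c : κ) :
    christoffel (b.prod b') g (Sum.inr a) (Sum.inr c) (Sum.inl i) z
      = if a = c then pd b i ρ z.1 / ρ z.1 else 0 := by
  rw [← h.christoffel_fibre_mixed (b := b) (b' := b') hz]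
  simp [christoffel, h.inv_eq hz, h.pd_mixed hz, h.pd_mixed' hz, h.pd_inr_base hz, add_comm]

/-- The Ricci tensor of a warped product, on vectors tangent to the base. The Christoffel symbols
with three fibre indices enter only multiplied by `Γᵃᵢⱼ = 0`, so the geometry of the fibre does not
matter. -/
theorem ricci_base (i j : ι) :
    ricci (b.prod b') g (Sum.inl i) (Sum.inl j) z
      = ricci b g₁ i j z.1 - Fintype.card κ / ρ z.1 * hess b g₁ ρ i j z.1 := by
  have hρ := h.warp_ne z hz
  have hρC := h.diff_warp z hz
  have hρd : DifferentiableAt ℝ ρ z.1 := hρC.differentiableAt (by norm_num)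
  have ev := h.eventually_mem hz
  have d1 : ∀ m k i j, pd (b.prod b') (Sum.inl m)
      (christoffel (b.prod b') g (Sum.inl k) (Sum.inl i) (Sum.inl j)) z
      = pd b m (christoffel b g₁ k i j) z.1 := fun m k i j => by
    rw [← pd_inl_comp_fst b b']
    exact pd_congr _ (ev.mono fun w hw => h.christoffel_base hw k i j) _
  have d2 : ∀ m a i j, pd (b.prod b') m
      (christoffel (b.prod b') g (Sum.inr a) (Sum.inl i) (Sum.inl j)) z = 0 := fun m a i j => by
    rw [pd_congr (b.prod b') (ev.mono fun w hw => h.christoffel_fibre_base hw a i j), pd_const]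
  have d3 : ∀ m a i, pd (b.prod b') (Sum.inl m)
      (christoffel (b.prod b') g (Sum.inr a) (Sum.inr a) (Sum.inl i)) z
      = pd b m (pd b i ρ) z.1 / ρ z.1 - pd b i ρ z.1 * pd b m ρ z.1 / ρ z.1 ^ 2 := fun m a i => by
    rw [pd_congr (b.prod b') (f' := fun w => pd b i ρ w.1 * (ρ w.1)⁻¹)
      (ev.mono fun w hw => by rw [h.christoffel_fibre_mixed' hw, if_pos rfl, div_eq_mul_inv]),
      pd_inl_comp_fst b b' (fun x => pd b i ρ x * (ρ x)⁻¹),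
      pd_mul b (differentiableAt_pd b hρC i) (hρd.fun_inv hρ)]
    have : pd b m (fun y => (ρ y)⁻¹) z.1 = -pd b m ρ z.1 / ρ z.1 ^ 2 := by
      have h1 : pd b m (fun y => ρ y * (ρ y)⁻¹) z.1 = 0 := by
        rw [pd_congr b (f' := fun _ => 1) ((hρC.continuousAt.eventually_ne hρ).mono
          fun y hy => mul_inv_cancel₀ hy), pd_const]
      rw [pd_mul b hρd (hρd.fun_inv hρ)] at h1
      field_simp at h1 ⊢
      linarith
    rw [this]
    ring
  simp only [ricci, hess, Fintype.sum_sum_type, d1, d2, d3, h.christoffel_base hz,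
    h.christoffel_base_mixed hz, h.christoffel_base_mixed' hz, h.christoffel_fibre_base hz,
    h.christoffel_fibre_mixed hz, h.christoffel_fibre_mixed' hz, pd_pd_comm b hρC j i]
  have hsum : ∑ k, pd b k ρ z.1 / ρ z.1 * christoffel b g₁ k i j z.1
      = (ρ z.1)⁻¹ * ∑ k, christoffel b g₁ k i j z.1 * pd b k ρ z.1 := by
    rw [Finset.mul_sum]
    exact Finset.sum_congr rfl fun k _ => by ring
  simp only [ite_mul, mul_ite, zero_mul, mul_zero, Finset.sum_const_zero, add_zero, zero_add,
    Finset.sum_ite_eq', Finset.mem_univ, if_true,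
    Finset.sum_const, Finset.card_univ, nsmul_eq_mul, hsum]
  ring

end IsWarpedOn
end Warped

/-! ### Components of tensors and curves in a chart -/

section ChartComponents

variable {ι : Type*} [Fintype ι]
variable {E : Type*} [NormedAddCommGroup E] [NormedSpace ℝ E]
variable {H : Type*} [TopologicalSpace H] {I : ModelWithCorners ℝ E H} [I.Boundaryless]
variable {M : Type*} [TopologicalSpace M] [ChartedSpace H M] [IsManifold I 1 M]

/-- The components, in the chart around `p`, of a tangent vector at a point `q` of the chart. -/
def chartComp (b : Module.Basis ι ℝ E) (p : M) {q : M} (v : TangentSpace I q) (i : ι) : ℝ :=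
  b.repr (mfderiv I 𝓘(ℝ, E) (extChartAt I p) q v : E) i

lemma mdifferentiableAt_extChartAt_symm {p : M} {x : E} (hx : x ∈ (extChartAt I p).target) :
    MDifferentiableAt 𝓘(ℝ, E) I (extChartAt I p).symm x := by
  have := mdifferentiableWithinAt_extChartAt_symm hx
  rwa [I.range_eq_univ, mdifferentiableWithinAt_univ] at this

/-- The expansion of a tangent vector in the coordinate vectors of a chart. -/
lemma eq_sum_coordVec (b : Module.Basis ι ℝ E) {p : M} {x : E} (hx : x ∈ (extChartAt I p).target)
    (v : TangentSpace I ((extChartAt I p).symm x)) :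
    v = ∑ i, chartComp b p v i • coordVec b p x i := by
  have h := mfderivWithin_extChartAt_symm_comp_mfderiv_extChartAt hx
  rw [I.range_eq_univ, mfderivWithin_univ] at h
  have h2 := congrArg (fun L => L v) h
  change mfderiv 𝓘(ℝ, E) I (extChartAt I p).symm x
    (mfderiv I 𝓘(ℝ, E) (extChartAt I p) ((extChartAt I p).symm x) v) = v at h2
  conv_lhs => rw [← h2, ← b.sum_repr (mfderiv I 𝓘(ℝ, E) (extChartAt I p) _ v : E)]
  exact map_sum (mfderiv 𝓘(ℝ, E) I (extChartAt I p).symm x).toLinearMap _ _ |>.trans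
    (Finset.sum_congr rfl fun i _ =>
      map_smul (mfderiv 𝓘(ℝ, E) I (extChartAt I p).symm x).toLinearMap _ _)

/-- Evaluation of a 2-tensor through its components in a chart. -/
lemma bilin_eq_sum (b : Module.Basis ι ℝ E) (h : TensorField2 I M) {p q : M}
    (hq : q ∈ (extChartAt I p).source) (u v : TangentSpace I q) :
    h q u v
      = ∑ i, ∑ j, comp b h p (extChartAt I p q) i j * chartComp b p u i * chartComp b p v j := by
  obtain ⟨x, hx, rfl⟩ : ∃ x ∈ (extChartAt I p).target, q = (extChartAt I p).symm x :=
    ⟨_, (extChartAt I p).map_source hq, ((extChartAt I p).left_inv hq).symm⟩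
  rw [(extChartAt I p).right_inv hx]
  conv_lhs => rw [eq_sum_coordVec b hx u, eq_sum_coordVec b hx v]
  simp only [map_sum, map_smul, LinearMap.sum_apply, LinearMap.smul_apply, smul_eq_mul, comp,
    Matrix.of_apply]
  simp only [Finset.mul_sum]
  rw [Finset.sum_comm]
  exact Finset.sum_congr rfl fun i _ => Finset.sum_congr rfl fun j _ => by ring

/-- Evaluation of a differential through the partial derivatives in a chart. -/
lemma mfderiv_eq_sum (b : Module.Basis ι ℝ E) {f : M → ℝ} {p q : M}
    (hq : q ∈ (extChartAt I p).source) (hf : MDifferentiableAt I 𝓘(ℝ, ℝ) f q)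
    (v : TangentSpace I q) :
    (mfderiv I 𝓘(ℝ, ℝ) f q v : ℝ)
      = ∑ i, chartComp b p v i * pd b i (f ∘ (extChartAt I p).symm) (extChartAt I p q) := by
  obtain ⟨x, hx, rfl⟩ : ∃ x ∈ (extChartAt I p).target, q = (extChartAt I p).symm x :=
    ⟨_, (extChartAt I p).map_source hq, ((extChartAt I p).left_inv hq).symm⟩
  rw [(extChartAt I p).right_inv hx]
  have h := mfderiv_comp x hf (mdifferentiableAt_extChartAt_symm hx)
  conv_lhs => rw [eq_sum_coordVec b hx v]
  refine (map_sum (mfderiv I 𝓘(ℝ, ℝ) f ((extChartAt I p).symm x)).toLinearMap _ _).trans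
    (Finset.sum_congr rfl fun i _ => ?_)
  refine (map_smul (mfderiv I 𝓘(ℝ, ℝ) f ((extChartAt I p).symm x)).toLinearMap _ _).trans ?_
  rw [pd, ← mfderiv_eq_fderiv, h]
  rfl

omit [Fintype ι] [I.Boundaryless] in
/-- The tangent space at `p` is identified with the model space through the chart around `p` itself,
so no coordinate change occurs. -/
lemma vecComp_eq (b : Module.Basis ι ℝ E) (p : M) (v : TangentSpace I p) (i : ι) :
    vecComp b p v i = b.repr (v : E) i := by
  rw [vecComp, mfderiv_extChartAt_self]
  rfl

omit [I.Boundaryless] in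
/-- The coordinate velocity of a curve has the velocity vector's components. -/
lemma hasDerivAt_extChartAt (b : Module.Basis ι ℝ E) {p : M} {γ : ℝ → M} {t : ℝ}
    (hγ : MDifferentiableAt 𝓘(ℝ, ℝ) I γ t) (ht : γ t ∈ (extChartAt I p).source) :
    HasDerivAt (fun t => extChartAt I p (γ t))
      (∑ i, chartComp b p (velocity (I := I) γ t) i • b i) t := by
  have h1 : MDifferentiableAt I 𝓘(ℝ, E) (extChartAt I p) (γ t) :=
    mdifferentiableAt_extChartAt (by rwa [extChartAt_source] at ht)
  have hd : DifferentiableAt ℝ (fun t => extChartAt I p (γ t)) t :=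
    mdifferentiableAt_iff_differentiableAt.1 (h1.comp t hγ)
  have h2 : fderiv ℝ (fun t => extChartAt I p (γ t)) t
      = (mfderiv I 𝓘(ℝ, E) (extChartAt I p) (γ t)).comp (mfderiv 𝓘(ℝ, ℝ) I γ t) := by
    rw [← mfderiv_eq_fderiv]
    exact mfderiv_comp t h1 hγ
  refine hd.hasDerivAt.congr_deriv ?_
  rw [← fderiv_apply_one_eq_deriv, h2]
  exact (b.sum_repr _).symm

omit [I.Boundaryless] in
lemma deriv_curveCoord (b : Module.Basis ι ℝ E) {p : M} {γ : ℝ → M} {t : ℝ}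
    (hγ : MDifferentiableAt 𝓘(ℝ, ℝ) I γ t) (ht : γ t ∈ (extChartAt I p).source) (k : ι) :
    deriv (curveCoord I b γ p k) t = chartComp b p (velocity (I := I) γ t) k := by
  have : FiniteDimensional ℝ E := b.finiteDimensional_of_finite
  let L : E →L[ℝ] ℝ := LinearMap.toContinuousLinearMap (b.coord k)
  have h := L.hasFDerivAt.comp_hasDerivAt t (hasDerivAt_extChartAt b hγ ht)
  have h2 : HasDerivAt (curveCoord I b γ p k) (chartComp b p (velocity (I := I) γ t) k) t := by
    refine h.congr_deriv ?_
    change b.repr (∑ i, _) k = _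
    rw [b.repr_sum_self]
  exact h2.deriv

end ChartComponents

/-! ### The round metric in a chart of the sphere -/

section Sphere

lemma contMDiff_coe_S2 :
    ContMDiff (𝓡 2) 𝓘(ℝ, EuclideanSpace ℝ (Fin 3)) 2
      (fun y : S2 => (y : EuclideanSpace ℝ (Fin 3))) := by
  have : Fact (Module.finrank ℝ (EuclideanSpace ℝ (Fin 3)) = 2 + 1) := ⟨by simp⟩
  exact contMDiff_coe_sphere

lemma sphereIncl_injective (x : S2) : Function.Injective (sphereIncl x) := by
  have : Fact (Module.finrank ℝ (EuclideanSpace ℝ (Fin 3)) = 2 + 1) := ⟨by simp⟩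
  convert! injective_mvfderiv_subtypeVal_sphere (n := 2) x

/-- The parametrization of the unit sphere in `ℝ³` by the coordinates of the chart around `x`. -/
def sphereParam (x : S2) (y : EuclideanSpace ℝ (Fin 2)) : EuclideanSpace ℝ (Fin 3) :=
  ((extChartAt (𝓡 2) x).symm y : S2)

lemma fderiv_sphereParam (x : S2) {y : EuclideanSpace ℝ (Fin 2)}
    (hy : y ∈ (extChartAt (𝓡 2) x).target) (v : EuclideanSpace ℝ (Fin 2)) :
    fderiv ℝ (sphereParam x) y v
      = sphereIncl _ (mfderiv 𝓘(ℝ, EuclideanSpace ℝ (Fin 2)) (𝓡 2) (extChartAt (𝓡 2) x).symm y v) := by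
  have h := mfderiv_comp y (contMDiff_coe_S2.mdifferentiableAt two_ne_zero)
    (mdifferentiableAt_extChartAt_symm hy)
  rw [mfderiv_eq_fderiv] at h
  exact congrArg (fun L => L v) h

/-- In a chart of the sphere the round metric is the Gram matrix of the partial derivatives of the
parametrization. -/
lemma comp_roundMetric (x : S2) {y : EuclideanSpace ℝ (Fin 2)}
    (hy : y ∈ (extChartAt (𝓡 2) x).target) (a c : Fin 2) :
    comp basis2 roundMetric x y a c
      = inner ℝ (fderiv ℝ (sphereParam x) y (basis2 a)) (fderiv ℝ (sphereParam x) y (basis2 c)) := by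
  rw [fderiv_sphereParam x hy, fderiv_sphereParam x hy]
  rfl

lemma differentiableAt_comp_roundMetric (x : S2) {y : EuclideanSpace ℝ (Fin 2)}
    (hy : y ∈ (extChartAt (𝓡 2) x).target) (a c : Fin 2) :
    DifferentiableAt ℝ (fun y => comp basis2 roundMetric x y a c) y := by
  have hU : (extChartAt (𝓡 2) x).target ∈ 𝓝 y := (isOpen_extChartAt_target x).mem_nhds hy
  have hC : ContDiffAt ℝ 2 (sphereParam x) y :=
    (contMDiffOn_iff_contDiffOn.1 (contMDiff_coe_S2.comp_contMDiffOn
      (contMDiffOn_extChartAt_symm (I := 𝓡 2) (n := 2) x))).contDiffAt hU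
  have hd : DifferentiableAt ℝ (fderiv ℝ (sphereParam x)) y :=
    (hC.fderiv_right (m := 1) (by norm_num)).differentiableAt (by norm_num)
  refine DifferentiableAt.congr_of_eventuallyEq (DifferentiableAt.inner ℝ
    (hd.clm_apply (differentiableAt_const (basis2 a)))
    (hd.clm_apply (differentiableAt_const (basis2 c)))) ?_
  filter_upwards [hU] with w hw using comp_roundMetric x hw a c

lemma comp_roundMetric_symm (x : S2) {y : EuclideanSpace ℝ (Fin 2)}
    (hy : y ∈ (extChartAt (𝓡 2) x).target) (a c : Fin 2) :
    comp basis2 roundMetric x y a c = comp basis2 roundMetric x y c a := by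
  rw [comp_roundMetric x hy, comp_roundMetric x hy, real_inner_comm]

lemma det_comp_roundMetric_ne_zero (x : S2) {y : EuclideanSpace ℝ (Fin 2)}
    (hy : y ∈ (extChartAt (𝓡 2) x).target) : (comp basis2 roundMetric x y).det ≠ 0 := by
  have hi := isInvertible_mfderivWithin_extChartAt_symm (I := 𝓡 2) hy
  rw [(𝓡 2).range_eq_univ, mfderivWithin_univ] at hi
  have hinj : Function.Injective (fderiv ℝ (sphereParam x) y) := by
    intro u v huv
    rw [fderiv_sphereParam x hy, fderiv_sphereParam x hy] at huv
    exact hi.injective (sphereIncl_injective _ huv)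
  have hli := basis2.linearIndependent.map' (fderiv ℝ (sphereParam x) y).toLinearMap
    (LinearMap.ker_eq_bot.2 hinj)
  have hdet := (Matrix.det_gram_ne_zero_iff_linearIndependent (𝕜 := ℝ)).2 hli
  have heq : comp basis2 roundMetric x y
      = Matrix.gram ℝ ((fderiv ℝ (sphereParam x) y).toLinearMap ∘ basis2) := by
    ext a c
    rw [comp_roundMetric x hy]
    rfl
  rwa [heq]

end Sphere

/-! ### The spacetime metric in a product chart -/

section Product

variable {N : Type*} [TopologicalSpace N] [ChartedSpace (EuclideanSpace ℝ (Fin 2)) N]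

lemma mem_extChartAt_target_prod (p : N × S2)
    (z : EuclideanSpace ℝ (Fin 2) × EuclideanSpace ℝ (Fin 2)) :
    z ∈ (extChartAt ((𝓡 2).prod (𝓡 2)) p).target ↔
      z.1 ∈ (extChartAt (𝓡 2) p.1).target ∧ z.2 ∈ (extChartAt (𝓡 2) p.2).target := by
  rw [extChartAt_prod]
  rfl

variable [IsManifold (𝓡 2) ∞ N]

lemma projN_mfderiv_symm (p : N × S2) {z : EuclideanSpace ℝ (Fin 2) × EuclideanSpace ℝ (Fin 2)}
    (hz : z ∈ (extChartAt ((𝓡 2).prod (𝓡 2)) p).target)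
    (v : EuclideanSpace ℝ (Fin 2) × EuclideanSpace ℝ (Fin 2)) :
    projN _ (mfderiv 𝓘(ℝ, EuclideanSpace ℝ (Fin 2) × EuclideanSpace ℝ (Fin 2))
        ((𝓡 2).prod (𝓡 2)) (extChartAt ((𝓡 2).prod (𝓡 2)) p).symm z v)
      = mfderiv 𝓘(ℝ, EuclideanSpace ℝ (Fin 2)) (𝓡 2) (extChartAt (𝓡 2) p.1).symm z.1 v.1 := by
  have hz' := (mem_extChartAt_target_prod p z).1 hz
  have h1 := mfderiv_comp z (mdifferentiableAt_fst (I := 𝓡 2) (I' := 𝓡 2))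
    (mdifferentiableAt_extChartAt_symm hz)
  have h2 := mfderiv_comp z (mdifferentiableAt_extChartAt_symm hz'.1)
    (differentiableAt_fst (𝕜 := ℝ) (p := z)).mdifferentiableAt
  rw [mfderiv_fst] at h1
  rw [mfderiv_eq_fderiv, fderiv_fst] at h2
  exact (congrArg (fun L => L v) h1).symm.trans (congrArg (fun L => L v) h2)

lemma projS_mfderiv_symm (p : N × S2) {z : EuclideanSpace ℝ (Fin 2) × EuclideanSpace ℝ (Fin 2)}
    (hz : z ∈ (extChartAt ((𝓡 2).prod (𝓡 2)) p).target)
    (v : EuclideanSpace ℝ (Fin 2) × EuclideanSpace ℝ (Fin 2)) :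
    projS _ (mfderiv 𝓘(ℝ, EuclideanSpace ℝ (Fin 2) × EuclideanSpace ℝ (Fin 2))
        ((𝓡 2).prod (𝓡 2)) (extChartAt ((𝓡 2).prod (𝓡 2)) p).symm z v)
      = mfderiv 𝓘(ℝ, EuclideanSpace ℝ (Fin 2)) (𝓡 2) (extChartAt (𝓡 2) p.2).symm z.2 v.2 := by
  have hz' := (mem_extChartAt_target_prod p z).1 hz
  have h1 := mfderiv_comp z (mdifferentiableAt_snd (I := 𝓡 2) (I' := 𝓡 2))
    (mdifferentiableAt_extChartAt_symm hz)
  have h2 := mfderiv_comp z (mdifferentiableAt_extChartAt_symm hz'.2)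
    (differentiableAt_snd (𝕜 := ℝ) (p := z)).mdifferentiableAt
  rw [mfderiv_snd] at h1
  rw [mfderiv_eq_fderiv, fderiv_snd] at h2
  exact (congrArg (fun L => L v) h1).symm.trans (congrArg (fun L => L v) h2)

/-- In the product chart the spacetime metric is the warped product of the components of `G` and of
the round metric. -/
lemma comp_spacetimeMetric (G : TensorField2 (𝓡 2) N) (r : N → ℝ) (p : N × S2)
    {z : EuclideanSpace ℝ (Fin 2) × EuclideanSpace ℝ (Fin 2)}
    (hz : z ∈ (extChartAt ((𝓡 2).prod (𝓡 2)) p).target) :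
    comp basis4 (spacetimeMetric G r) p z = Matrix.fromBlocks (comp basis2 G p.1 z.1) 0 0
      ((r ∘ (extChartAt (𝓡 2) p.1).symm) z.1 ^ 2 • comp basis2 roundMetric p.2 z.2) := by
  have key : ∀ i j, comp basis4 (spacetimeMetric G r) p z i j
      = G ((extChartAt (𝓡 2) p.1).symm z.1)
        (mfderiv 𝓘(ℝ, EuclideanSpace ℝ (Fin 2)) (𝓡 2) (extChartAt (𝓡 2) p.1).symm z.1 (basis4 i).1)
        (mfderiv 𝓘(ℝ, EuclideanSpace ℝ (Fin 2)) (𝓡 2) (extChartAt (𝓡 2) p.1).symm z.1 (basis4 j).1)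
      + (r ∘ (extChartAt (𝓡 2) p.1).symm) z.1 ^ 2 * roundMetric ((extChartAt (𝓡 2) p.2).symm z.2)
        (mfderiv 𝓘(ℝ, EuclideanSpace ℝ (Fin 2)) (𝓡 2) (extChartAt (𝓡 2) p.2).symm z.2 (basis4 i).2)
        (mfderiv 𝓘(ℝ, EuclideanSpace ℝ (Fin 2)) (𝓡 2) (extChartAt (𝓡 2) p.2).symm z.2
          (basis4 j).2) := by
    intro i j
    rw [← projN_mfderiv_symm p hz, ← projN_mfderiv_symm p hz, ← projS_mfderiv_symm p hz,
      ← projS_mfderiv_symm p hz]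
    rfl
  have h1 : mfderiv 𝓘(ℝ, EuclideanSpace ℝ (Fin 2)) (𝓡 2) (extChartAt (𝓡 2) p.1).symm z.1
      (0 : EuclideanSpace ℝ (Fin 2)) = 0 := map_zero _
  have h2 : mfderiv 𝓘(ℝ, EuclideanSpace ℝ (Fin 2)) (𝓡 2) (extChartAt (𝓡 2) p.2).symm z.2
      (0 : EuclideanSpace ℝ (Fin 2)) = 0 := map_zero _
  ext i j
  rw [key]
  rcases i with i | i <;> rcases j with j | j <;>
    simp only [comp, coordVec, Module.Basis.prod_apply_inl_fst, Module.Basis.prod_apply_inl_snd,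
      Module.Basis.prod_apply_inr_fst, Module.Basis.prod_apply_inr_snd, h1, h2, map_zero, add_zero,
      zero_add, mul_zero, LinearMap.zero_apply, Matrix.fromBlocks_apply₁₁, Matrix.fromBlocks_apply₁₂,
      Matrix.fromBlocks_apply₂₁, Matrix.fromBlocks_apply₂₂, Matrix.of_apply, Matrix.zero_apply,
      Matrix.smul_apply, smul_eq_mul]

end Product

/-! ### Duals and energy on a Lorentzian surface -/

section LorentzSurface

variable {N : Type*} [TopologicalSpace N] [ChartedSpace (EuclideanSpace ℝ (Fin 2)) N]
variable {G ε : TensorField2 (𝓡 2) N}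

/-- The determinant of the components in a spanning pair is, up to the square of the determinant of
the change of basis, that of an orthonormal frame, which is `-1`. -/
lemma IsLorentzMetric.det_ne_zero (hG : IsLorentzMetric G) (q : N)
    (w : Fin 2 → TangentSpace (𝓡 2) q)
    (hw : ∀ v, ∃ c : Fin 2 → ℝ, v = ∑ i, c i • w i) :
    (Matrix.of fun i j => G q (w i) (w j)).det ≠ 0 := by
  obtain ⟨u, v, huu, hvv, huv⟩ := hG.frame q
  obtain ⟨c, rfl⟩ := hw u
  obtain ⟨d, rfl⟩ := hw v
  simp only [Fin.sum_univ_two, map_add, map_smul, LinearMap.add_apply, LinearMap.smul_apply,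
    smul_eq_mul, hG.symm q (w 1) (w 0)] at huu hvv huv
  rw [Matrix.det_fin_two]
  simp only [Matrix.of_apply, hG.symm q (w 1) (w 0)]
  intro h
  have : (c 0 * d 1 - c 1 * d 0) ^ 2
      * (G q (w 0) (w 0) * G q (w 1) (w 1) - G q (w 0) (w 1) * G q (w 0) (w 1)) = -1 := by
    have e1 := congrArg₂ (fun a b : ℝ => a * b) huu hvv
    have e2 := congrArg (fun a : ℝ => a ^ 2) huv
    linear_combination e1 - e2
  rw [h, mul_zero] at this
  norm_num at this

lemma IsLorentzMetric.det_lower_ne_zero (hG : IsLorentzMetric G) (q : N) :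
    (lower (G q)).det ≠ 0 :=
  hG.det_ne_zero q (tbasis q) fun v => ⟨_, ((tbasis q).sum_repr v).symm⟩

lemma IsAreaForm.neg_swap (hε : IsAreaForm G ε) (q : N) (u v : TangentSpace (𝓡 2) q) :
    ε q u v = -ε q v u := by
  have h := hε.alternating q (u + v)
  simp only [map_add, LinearMap.add_apply, hε.alternating, zero_add, add_zero] at h
  linarith

lemma bilin_eq_sum_lower {q : N} (h : LinearMap.BilinForm ℝ (TangentSpace (𝓡 2) q))
    (u v : TangentSpace (𝓡 2) q) :
    h u v = ∑ A, ∑ B, lower h A B * (tbasis q).repr u A * (tbasis q).repr v B := by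
  conv_lhs => rw [← (tbasis q).sum_repr u, ← (tbasis q).sum_repr v]
  simp only [map_sum, map_smul, LinearMap.sum_apply, LinearMap.smul_apply, smul_eq_mul, lower,
    Matrix.of_apply, Finset.mul_sum]
  rw [Finset.sum_comm]
  exact Finset.sum_congr rfl fun i _ => Finset.sum_congr rfl fun j _ => by ring

lemma repr_dualVec (q : N) (v : TangentSpace (𝓡 2) q) (A : Fin 2) :
    (tbasis q).repr (dualVec G ε q v) A = ∑ B, epsMixed G ε q B A * (tbasis q).repr v B := by
  rw [dualVec, (tbasis q).repr_sum_self]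

lemma epsMixed_eq (q : N) (A B : Fin 2) :
    epsMixed G ε q A B = (lower (ε q) * (lower (G q))⁻¹) A B := rfl

/-- The dual vector is characterized without a basis by `G(v~, w) = ε(v, w)`. -/
lemma IsLorentzMetric.apply_dualVec (hG : IsLorentzMetric G) (q : N)
    (v w : TangentSpace (𝓡 2) q) : G q (dualVec G ε q v) w = ε q v w := by
  have h : ∀ B D, lower (ε q) B D = ∑ A, epsMixed G ε q B A * lower (G q) A D := by
    intro B D
    simp only [epsMixed_eq]
    rw [← Matrix.mul_apply, Matrix.mul_assoc, Matrix.nonsing_inv_mul _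
      (isUnit_iff_ne_zero.2 (hG.det_lower_ne_zero q)), Matrix.mul_one]
  rw [bilin_eq_sum_lower, bilin_eq_sum_lower]
  simp only [repr_dualVec, h, Fin.sum_univ_two]
  ring

/-- The energy is `dr(k̄~)`, with `k̄~` the dual of the projection of `k` to `N`. -/
lemma IsLorentzMetric.energy_eq (hG : IsLorentzMetric G) (r : N → ℝ) (p : N × S2)
    (k : TangentSpace ((𝓡 2).prod (𝓡 2)) p) :
    energy G ε r p k = dfun r p.1 (dualVec G ε p.1 (projN p k)) := by
  set q := p.1
  set v : TangentSpace (𝓡 2) q := projN p k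
  have h1 : energy G ε r p k = -G q v (kodamaN G ε r q) := by
    have : roundMetric p.2 (projS p k) (projS p (kodama G ε r p)) = 0 := by
      rw [show projS p (kodama G ε r p) = 0 from rfl, map_zero]
    simp only [energy, spacetimeMetric, LinearMap.add_apply, LinearMap.smul_apply,
      LinearMap.compl₁₂_apply, this, smul_zero, add_zero]
    rfl
  have hsymm : (lower (G q))ᵀ = lower (G q) := by
    ext A B
    exact hG.symm _ _ _
  have hup : epsUp G ε q = (lower (G q))⁻¹ * lower (ε q) * (lower (G q))⁻¹ := by
    have hi : ((lower (G q))⁻¹)ᵀ = (lower (G q))⁻¹ := by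
      rw [Matrix.transpose_nonsing_inv, hsymm]
    have hup : epsUp G ε q = (lower (G q))⁻¹ * lower (ε q) * ((lower (G q))⁻¹)ᵀ := by
      ext A B
      simp only [epsUp, inv, Matrix.mul_apply, Matrix.transpose_apply, Fin.sum_univ_two]
      ring
    rw [hup, hi]
  -- `G_AC ε^CB = ε_A^B`
  have h2 : ∀ A B, ∑ C, lower (G q) A C * epsUp G ε q C B = epsMixed G ε q A B := by
    intro A B
    rw [epsMixed_eq, hup, ← Matrix.mul_apply, Matrix.mul_assoc, ← Matrix.mul_assoc,
      Matrix.mul_nonsing_inv _ (isUnit_iff_ne_zero.2 (hG.det_lower_ne_zero q)), Matrix.one_mul]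
  have h3 : ∀ A, (tbasis q).repr (kodamaN G ε r q) A
      = -∑ B, epsUp G ε q A B * dfun r q (tbasis q B) := by
    intro A
    rw [kodamaN, (tbasis q).repr_sum_self]
  have h4 : dfun r q (dualVec G ε q v)
      = ∑ A, (∑ B, epsMixed G ε q B A * (tbasis q).repr v B) * dfun r q (tbasis q A) := by
    refine (map_sum (mfderiv (𝓡 2) 𝓘(ℝ, ℝ) r q).toLinearMap _ _).trans
      (Finset.sum_congr rfl fun A _ => ?_)
    exact map_smul (mfderiv (𝓡 2) 𝓘(ℝ, ℝ) r q).toLinearMap _ _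
  rw [h1, h4, bilin_eq_sum_lower]
  simp only [h3, ← h2, Fin.sum_univ_two]
  ring

/-- The trace part of `T_N` does not contribute to `T̃(k, k)`, because `G(k̄~, k̄) = ε(k̄, k̄) = 0`. -/
lemma IsLorentzMetric.dualT_eq (hG : IsLorentzMetric G) (hε : IsAreaForm G ε)
    (T : TensorField2 ((𝓡 2).prod (𝓡 2)) (N × S2)) (p : N × S2)
    (k : TangentSpace ((𝓡 2).prod (𝓡 2)) p) :
    dualT G ε T p k k
      = T p (inclN p (dualVec G ε p.1 (projN p k))) (inclN p (projN p k)) := by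
  have h1 : G p.1 (dualVec G ε p.1 (projN p k)) (projN p k) = 0 := by
    rw [hG.apply_dualVec, hε.alternating]
  have h2 : T p (inclN p (dualVec G ε p.1 (projN p k))) (inclN p (projN p k))
      = restrictN T p (dualVec G ε p.1 (projN p k)) (projN p k) := rfl
  rw [h2, bilin_eq_sum_lower]
  rw [bilin_eq_sum_lower] at h1
  simp only [repr_dualVec] at h1 ⊢
  simp only [dualT, traceFree]
  set c := ∑ C, ∑ D, inv G p.1 C D * lower (restrictN T p) C D
  simp only [Fin.sum_univ_two] at h1 ⊢
  linear_combination -(1 / 2) * c * h1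

variable [IsManifold (𝓡 2) ∞ N]

lemma IsLorentzMetric.det_comp_ne_zero (hG : IsLorentzMetric G) (p : N)
    {x : EuclideanSpace ℝ (Fin 2)} (hx : x ∈ (extChartAt (𝓡 2) p).target) :
    (comp basis2 G p x).det ≠ 0 :=
  hG.det_ne_zero _ (coordVec basis2 p x) fun v => ⟨_, eq_sum_coordVec basis2 hx v⟩

/-- The formula `(v~)ʲ = vᵏ εₖₗ gˡʲ` in an arbitrary chart, not only in the chart around the base
point of the vector that defines `dualVec`. -/
lemma IsLorentzMetric.chartComp_dualVec (hG : IsLorentzMetric G) {p q : N}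
    (hq : q ∈ (extChartAt (𝓡 2) p).source) (v : TangentSpace (𝓡 2) q) (j : Fin 2) :
    chartComp basis2 p (dualVec G ε q v) j
      = ∑ k, ∑ l, chartComp basis2 p v k * comp basis2 ε p (extChartAt (𝓡 2) p q) k l
        * (comp basis2 G p (extChartAt (𝓡 2) p q))⁻¹ l j := by
  obtain ⟨x, hx, rfl⟩ : ∃ x ∈ (extChartAt (𝓡 2) p).target, q = (extChartAt (𝓡 2) p).symm x :=
    ⟨_, (extChartAt (𝓡 2) p).map_source hq, ((extChartAt (𝓡 2) p).left_inv hq).symm⟩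
  rw [(extChartAt (𝓡 2) p).right_inv hx]
  set m : Fin 2 → ℝ := chartComp basis2 p (dualVec G ε _ v)
  -- `G(v~, ∂_D) = ε(v, ∂_D)` in components; multiplication by the inverse metric gives the claim.
  have key : m ᵥ* comp basis2 G p x = chartComp basis2 p v ᵥ* comp basis2 ε p x := by
    ext D
    have h := hG.apply_dualVec (ε := ε) _ v (coordVec basis2 p x D)
    rw [eq_sum_coordVec basis2 hx (dualVec G ε _ v)] at h
    conv_rhs at h => rw [eq_sum_coordVec basis2 hx v]
    simp only [map_sum, map_smul, LinearMap.sum_apply, LinearMap.smul_apply, smul_eq_mul] at h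
    exact h
  have h2 : m = (chartComp basis2 p v ᵥ* comp basis2 ε p x) ᵥ* (comp basis2 G p x)⁻¹ := by
    rw [← key, Matrix.vecMul_vecMul, Matrix.mul_nonsing_inv _
      (isUnit_iff_ne_zero.2 (hG.det_comp_ne_zero p hx)), Matrix.vecMul_one]
  rw [h2]
  simp only [Matrix.vecMul, dotProduct, Finset.sum_mul]
  exact Finset.sum_comm

end LorentzSurface

/-! ### The Einstein tensor and geodesics of the spacetime -/

section Spacetime

variable {N : Type*} [TopologicalSpace N] [ChartedSpace (EuclideanSpace ℝ (Fin 2)) N]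
  [IsManifold (𝓡 2) ∞ N] {G ε : TensorField2 (𝓡 2) N} {r : N → ℝ}

lemma contDiffAt_comp_symm (hr : ContMDiff (𝓡 2) 𝓘(ℝ, ℝ) 2 r) {q : N}
    {x : EuclideanSpace ℝ (Fin 2)} (hx : x ∈ (extChartAt (𝓡 2) q).target) :
    ContDiffAt ℝ 2 (r ∘ (extChartAt (𝓡 2) q).symm) x :=
  (contMDiffOn_iff_contDiffOn.1 (hr.comp_contMDiffOn
    (contMDiffOn_extChartAt_symm (I := 𝓡 2) (n := 2) q))).contDiffAt
    ((isOpen_extChartAt_target q).mem_nhds hx)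

lemma isWarpedOn_spacetimeMetric (hG : IsLorentzMetric G) (hr : ContMDiff (𝓡 2) 𝓘(ℝ, ℝ) 2 r)
    (hrpos : ∀ q, 0 < r q) (p : N × S2) :
    IsWarpedOn (comp basis4 (spacetimeMetric G r) p) (comp basis2 G p.1)
      (r ∘ (extChartAt (𝓡 2) p.1).symm) (comp basis2 roundMetric p.2)
      (extChartAt ((𝓡 2).prod (𝓡 2)) p).target where
  isOpen := isOpen_extChartAt_target p
  eq _ hz := comp_spacetimeMetric G r p hz
  diff_warp _ hz := contDiffAt_comp_symm hr ((mem_extChartAt_target_prod p _).1 hz).1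
  warp_ne _ _ := (hrpos _).ne'
  diff_fibre _ hz := differentiableAt_comp_roundMetric p.2 ((mem_extChartAt_target_prod p _).1 hz).2
  symm_fibre _ hz := comp_roundMetric_symm p.2 ((mem_extChartAt_target_prod p _).1 hz).2
  det_base _ hz := hG.det_comp_ne_zero p.1 ((mem_extChartAt_target_prod p _).1 hz).1
  det_fibre _ hz := det_comp_roundMetric_ne_zero p.2 ((mem_extChartAt_target_prod p _).1 hz).2

/-- On a pair of `G`-orthogonal vectors tangent to `N` the Einstein tensor is `-(2/r) ∇∇r`: the Ricci
tensor of `G` and the scalar curvature term are multiples of `G`. -/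
lemma einsteinTensor_inclN (hG : IsLorentzMetric G) (hr : ContMDiff (𝓡 2) 𝓘(ℝ, ℝ) 2 r)
    (hrpos : ∀ q, 0 < r q) (p : N × S2) {u w : TangentSpace (𝓡 2) p.1} (huw : G p.1 u w = 0) :
    einsteinTensor basis4 (spacetimeMetric G r) p (inclN p u) (inclN p w)
      = -(2 / r p.1) * ∑ i, ∑ j, hess basis2 (comp basis2 G p.1) (r ∘ (extChartAt (𝓡 2) p.1).symm)
        i j (extChartAt (𝓡 2) p.1 p.1) * chartComp basis2 p.1 u i * chartComp basis2 p.1 w j := by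
  have hW := isWarpedOn_spacetimeMetric hG hr hrpos p
  have hz := mem_extChartAt_target (I := (𝓡 2).prod (𝓡 2)) p
  have hx := mem_extChartAt_target (I := 𝓡 2) p.1
  have hU := (isOpen_extChartAt_target (I := 𝓡 2) p.1).mem_nhds hx
  obtain ⟨c, hc⟩ := exists_ricci_eq_mul basis2
    (fun i j => (hG.regular p.1 i j).contDiffAt hU)
    (Eventually.of_forall fun y i j => hG.symm _ _ _) (hG.det_comp_ne_zero p.1 hx)
  have hl : ∀ (v : TangentSpace (𝓡 2) p.1) A,
      vecComp basis4 p (inclN p v) (Sum.inl A) = chartComp basis2 p.1 v A := fun v A => by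
    rw [show chartComp basis2 p.1 v A = vecComp basis2 p.1 v A from rfl, vecComp_eq, vecComp_eq]
    exact Module.Basis.prod_repr_inl _ _ _ _
  have hrr : ∀ (v : TangentSpace (𝓡 2) p.1) a,
      vecComp basis4 p (inclN p v) (Sum.inr a) = 0 := fun v a => by
    rw [vecComp_eq]
    refine (Module.Basis.prod_repr_inr basis2 basis2 _ _).trans ?_
    change basis2.repr (0 : EuclideanSpace ℝ (Fin 2)) a = 0
    simp
  have hric : ∀ i j, einsteinComp basis4 (comp basis4 (spacetimeMetric G r) p) (Sum.inl i)
      (Sum.inl j) (extChartAt ((𝓡 2).prod (𝓡 2)) p p)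
      = (c - (1 / 2) * scalarCurv basis4 (comp basis4 (spacetimeMetric G r) p)
          (extChartAt ((𝓡 2).prod (𝓡 2)) p p)) * comp basis2 G p.1 (extChartAt (𝓡 2) p.1 p.1) i j
        - 2 / r p.1 * hess basis2 (comp basis2 G p.1) (r ∘ (extChartAt (𝓡 2) p.1).symm)
          i j (extChartAt (𝓡 2) p.1 p.1) := by
    intro i j
    have e1 : (extChartAt ((𝓡 2).prod (𝓡 2)) p p).1 = extChartAt (𝓡 2) p.1 p.1 := rfl
    have e2 : (r ∘ (extChartAt (𝓡 2) p.1).symm) (extChartAt (𝓡 2) p.1 p.1) = r p.1 :=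
      congrArg r (extChartAt_to_inv (I := 𝓡 2) p.1)
    rw [einsteinComp, hW.ricci_base hz, hW.eq _ hz, Matrix.fromBlocks_apply₁₁, e1, e2, hc,
      Fintype.card_fin]
    push_cast
    ring
  rw [bilin_eq_sum basis2 G (mem_extChartAt_source (I := 𝓡 2) p.1)] at huw
  simp only [einsteinTensor, Fintype.sum_sum_type, hl, hrr, hric, mul_zero, zero_mul,
    Finset.sum_const_zero, add_zero]
  simp only [Fin.sum_univ_two] at huw ⊢
  linear_combination (c - (1 / 2) * scalarCurv basis4 (comp basis4 (spacetimeMetric G r) p)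
          (extChartAt ((𝓡 2).prod (𝓡 2)) p p)) * huw

omit [IsManifold (𝓡 2) ∞ N] in
lemma projN_velocity {γ : ℝ → N × S2} {t : ℝ}
    (hγ : MDifferentiableAt 𝓘(ℝ, ℝ) ((𝓡 2).prod (𝓡 2)) γ t) :
    projN (γ t) (velocity γ t) = velocity (I := 𝓡 2) (fun t => (γ t).1) t := by
  have h := mfderiv_comp t (mdifferentiableAt_fst (I := 𝓡 2) (I' := 𝓡 2)) hγ
  rw [mfderiv_fst] at h
  exact (congrArg (fun L => L (1 : ℝ)) h).symm

omit [IsManifold (𝓡 2) ∞ N] in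
lemma curveCoord_inl (γ : ℝ → N × S2) (p : N × S2) (A : Fin 2) :
    curveCoord ((𝓡 2).prod (𝓡 2)) basis4 γ p (Sum.inl A)
      = curveCoord (𝓡 2) basis2 (fun t => (γ t).1) p.1 A := by
  ext t
  exact Module.Basis.prod_repr_inl _ _ _ _

/-- The rate of change of the energy along a geodesic is `∇∇r(k̄, k̄~)`. -/
theorem hasDerivAt_energy (hG : IsLorentzMetric G) (hε : IsAreaForm G ε)
    (hr : ContMDiff (𝓡 2) 𝓘(ℝ, ℝ) 2 r) (hrpos : ∀ q, 0 < r q) {J : Set ℝ} (hJ : IsOpen J)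
    {γ : ℝ → N × S2} (hγ : IsGeodesicOn basis4 (spacetimeMetric G r) γ J) {s : ℝ} (hs : s ∈ J) :
    HasDerivAt (fun t => energy G ε r (γ t) (velocity γ t))
      (∑ i, ∑ j, hess basis2 (comp basis2 G (γ s).1) (r ∘ (extChartAt (𝓡 2) (γ s).1).symm) i j
          (extChartAt (𝓡 2) (γ s).1 (γ s).1)
        * chartComp basis2 (γ s).1 (projN (γ s) (velocity γ s)) i
        * chartComp basis2 (γ s).1 (dualVec G ε (γ s).1 (projN (γ s) (velocity γ s))) j) s := by
  set p := γ s with hp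
  set β : ℝ → N := fun t => (γ t).1 with hβ
  set q : N := p.1 with hq
  set ρ := r ∘ (extChartAt (𝓡 2) q).symm with hρ
  set X : ℝ → EuclideanSpace ℝ (Fin 2) := fun t => extChartAt (𝓡 2) q (β t) with hX
  -- `X` and `V` are the position and velocity of the projected curve in the chart around `(γ s).1`,
  -- which is kept fixed while `t` varies near `s`.
  set V : Fin 2 → ℝ → ℝ := fun i => deriv (curveCoord (𝓡 2) basis2 β q i) with hV
  have hW := isWarpedOn_spacetimeMetric hG hr hrpos p
  have hz := mem_extChartAt_target (I := (𝓡 2).prod (𝓡 2)) p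
  have hx : X s ∈ (extChartAt (𝓡 2) q).target := mem_extChartAt_target (I := 𝓡 2) q
  have hU := (isOpen_extChartAt_target (I := 𝓡 2) q).mem_nhds hx
  have hγC : ContMDiffAt 𝓘(ℝ, ℝ) ((𝓡 2).prod (𝓡 2)) 2 γ s := hγ.1.contMDiffAt (hJ.mem_nhds hs)
  have hβC : ContMDiffAt 𝓘(ℝ, ℝ) (𝓡 2) 2 β s := hγC.fst
  have hγd : ∀ᶠ t in 𝓝 s, MDifferentiableAt 𝓘(ℝ, ℝ) ((𝓡 2).prod (𝓡 2)) γ t := by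
    filter_upwards [hJ.mem_nhds hs] with t ht
    exact (hγ.1.contMDiffAt (hJ.mem_nhds ht)).mdifferentiableAt two_ne_zero
  have hsrc : ∀ᶠ t in 𝓝 s, β t ∈ (extChartAt (𝓡 2) q).source :=
    hβC.continuousAt.eventually_mem (extChartAt_source_mem_nhds (I := 𝓡 2) q)
  have hVel : ∀ᶠ t in 𝓝 s, ∀ i, chartComp basis2 q (projN (γ t) (velocity γ t)) i = V i t := by
    filter_upwards [hγd, hsrc] with t h1 h2 i
    rw [projN_velocity h1]
    exact (deriv_curveCoord basis2 h1.fst h2 i).symm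
  have hXd : HasDerivAt X (∑ i, V i s • basis2 i) s := by
    have h := hasDerivAt_extChartAt basis2 hγd.self_of_nhds.fst hsrc.self_of_nhds
    refine h.congr_deriv (Finset.sum_congr rfl fun i _ => ?_)
    rw [← hVel.self_of_nhds i, projN_velocity hγd.self_of_nhds]
  have hVd : ∀ k, HasDerivAt (V k) (deriv (V k) s) s := by
    intro k
    have h1 : ContDiffAt ℝ 2 X s := (contMDiffAt_iff_contDiffAt.1
      ((contMDiffAt_extChartAt (I := 𝓡 2) (n := 2) (x := q)).comp s hβC))
    have h2 : ContDiffAt ℝ 2 (curveCoord (𝓡 2) basis2 β q k) s :=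
      (LinearMap.toContinuousLinearMap (basis2.coord k)).contDiff.contDiffAt.comp s h1
    have h3 : ContDiffAt ℝ 1 (fderiv ℝ (curveCoord (𝓡 2) basis2 β q k)) s :=
      h2.fderiv_right (by norm_num)
    have h4 := (h3.differentiableAt one_ne_zero).clm_apply (differentiableAt_const (1 : ℝ))
    exact DifferentiableAt.hasDerivAt h4
  have hρC : ContDiffAt ℝ 2 ρ (X s) := contDiffAt_comp_symm hr hx
  -- The fibre part of the geodesic equation accelerates the projected curve along the gradient of
  -- `r`, with a factor that is `r` times the squared norm of the velocity along the unit sphere.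
  have hacc := fun k => hγ.2 s hs (Sum.inl k)
  have e1 : (extChartAt ((𝓡 2).prod (𝓡 2)) p p).1 = X s := rfl
  have e2 : (extChartAt ((𝓡 2).prod (𝓡 2)) p p).2 = extChartAt (𝓡 2) p.2 p.2 := rfl
  have e3 : ∀ i, deriv (curveCoord (𝓡 2) basis2 (fun t => (γ t).1) p.1 i) = V i := fun _ => rfl
  have e4 : r ∘ (extChartAt (𝓡 2) p.1).symm = ρ := rfl
  have key := hasDerivAt_dual_grad basis2 (g := comp basis2 G q) (ε := comp basis2 ε q)
    (σ := ρ (X s) * ∑ a, ∑ c, comp basis2 roundMetric p.2 (extChartAt (𝓡 2) p.2 p.2) a c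
      * deriv (curveCoord ((𝓡 2).prod (𝓡 2)) basis4 γ p (Sum.inr a)) s
      * deriv (curveCoord ((𝓡 2).prod (𝓡 2)) basis4 γ p (Sum.inr c)) s)
    (fun i j => (hG.regular q i j).contDiffAt hU)
    (Eventually.of_forall fun y i j => hG.symm _ _ _) (hG.det_comp_ne_zero q hx)
    (fun i j => ((hε.regular q i j).contDiffAt hU).differentiableAt two_ne_zero)
    (Eventually.of_forall fun y i j => hε.neg_swap _ _ _)
    (Eventually.of_forall fun y => by
      rw [Matrix.det_fin_two]
      exact hε.normalized _ _ _)
    hρC hXd hVd (fun k => by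
      have h := hacc k
      simp only [Fintype.sum_sum_type, ← hp, hW.christoffel_base hz,
        hW.christoffel_base_mixed hz, hW.christoffel_base_mixed' hz,
        hW.christoffel_base_fibre hz, curveCoord_inl] at h
      simp only [e1, e2, e3, e4, Fin.sum_univ_two] at h ⊢
      linear_combination h)
  have hdual : ∀ᶠ t in 𝓝 s, ∀ j,
      chartComp basis2 q (dualVec G ε (γ t).1 (projN (γ t) (velocity γ t))) j
        = ∑ k, ∑ l, V k t * comp basis2 ε q (X t) k l * (comp basis2 G q (X t))⁻¹ l j := by
    filter_upwards [hVel, hsrc] with t h1 h2 j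
    refine (hG.chartComp_dualVec h2 _ j).trans
      (Finset.sum_congr rfl fun k _ => Finset.sum_congr rfl fun l _ => ?_)
    rw [← h1]
  refine HasDerivAt.congr_of_eventuallyEq (key.congr_deriv ?_) ?_
  · refine Finset.sum_congr rfl fun i _ => Finset.sum_congr rfl fun j _ => ?_
    rw [← hVel.self_of_nhds i, ← hdual.self_of_nhds j]
  · filter_upwards [hdual, hsrc] with t h1 h2
    rw [hG.energy_eq]
    have h3 : dfun r (γ t).1 (dualVec G ε (γ t).1 (projN (γ t) (velocity γ t)))
        = ∑ j, chartComp basis2 q (dualVec G ε (γ t).1 (projN (γ t) (velocity γ t))) j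
          * pd basis2 j ρ (X t) :=
      mfderiv_eq_sum basis2 h2 (hr.mdifferentiableAt two_ne_zero) _
    rw [h3]
    simp only [h1, Fin.sum_univ_two]
    ring

end Spacetime

end Redshift

end

theorem mainTheorem2 {N : Type*} [TopologicalSpace N] [ChartedSpace (EuclideanSpace ℝ (Fin 2)) N]
    [IsManifold (𝓡 2) ∞ N]
    (G : Redshift.TensorField2 (𝓡 2) N) (hG : Redshift.IsLorentzMetric G)
    (ε : Redshift.TensorField2 (𝓡 2) N) (hε : Redshift.IsAreaForm G ε)
    (r : N → ℝ) (hr : ContMDiff (𝓡 2) 𝓘(ℝ, ℝ) 2 r) (hrpos : ∀ q, 0 < r q)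
    (T : Redshift.TensorField2 ((𝓡 2).prod (𝓡 2)) (N × Redshift.S2))
    (hT : ∀ (p : N × Redshift.S2) (u v : TangentSpace ((𝓡 2).prod (𝓡 2)) p),
      Redshift.einsteinTensor Redshift.basis4 (Redshift.spacetimeMetric G r) p u v
        = 8 * Real.pi * T p u v)
    (J : Set ℝ) (hJ : IsOpen J) (γ : ℝ → N × Redshift.S2)
    (hγ : Redshift.IsGeodesicOn Redshift.basis4 (Redshift.spacetimeMetric G r) γ J)
    (hcausal : (∀ s ∈ J, Redshift.IsNull (Redshift.spacetimeMetric G r) (Redshift.velocity γ s)) ∨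
      (∀ s ∈ J, Redshift.IsTimelike (Redshift.spacetimeMetric G r) (Redshift.velocity γ s))) :
    ∀ s ∈ J,
      HasDerivAt (fun t => Redshift.energy G ε r (γ t) (Redshift.velocity γ t))
        (-4 * Real.pi * r (γ s).1
          * Redshift.dualT G ε T (γ s) (Redshift.velocity γ s) (Redshift.velocity γ s)) s ∧
      HasDerivAt (fun t => Redshift.energy G ε r (γ t) (Redshift.velocity γ t))
        (-(Redshift.massFlux G ε r T (γ s) (Redshift.velocity γ s) / r (γ s).1)) s := by
  intro s hs
  have hE := Redshift.hasDerivAt_energy hG hε hr hrpos hJ hγ hs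
  set p := γ s
  set k := Redshift.projN p (Redshift.velocity γ s) with hk
  set m := Redshift.dualVec G ε p.1 k with hm
  have hmk : G p.1 m k = 0 := by rw [hm, hG.apply_dualVec, hε.alternating]
  have hkm : G p.1 k m = 0 := by rw [hG.symm, hmk]
  have hr0 := (hrpos p.1).ne'
  have hsolve : ∀ S τ : ℝ, 8 * Real.pi * τ = -(2 / r p.1) * S →
      S = -4 * Real.pi * r p.1 * τ := by
    intro S τ h
    have e : r p.1 * (2 / r p.1) = 2 := mul_div_cancel₀ 2 hr0
    linear_combination r p.1 / 2 * h - S / 2 * e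
  have h1 := hsolve _ _ ((hT p _ _).symm.trans (Redshift.einsteinTensor_inclN hG hr hrpos p hkm))
  have h2 := hsolve _ _ ((hT p _ _).symm.trans (Redshift.einsteinTensor_inclN hG hr hrpos p hmk))
  constructor
  · refine hE.congr_deriv (Eq.trans ?_ (h2.trans ?_))
    · rw [Finset.sum_comm]
      refine Finset.sum_congr rfl fun i _ => Finset.sum_congr rfl fun j _ => ?_
      rw [Redshift.hess_symm Redshift.basis2 (g := Redshift.comp Redshift.basis2 G p.1)
        (Filter.Eventually.of_forall fun y i j =>
        hG.symm _ _ _) (Redshift.contDiffAt_comp_symm hr (mem_extChartAt_target p.1)) j i]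
      ring
    · rw [hG.dualT_eq hε]
  · refine hE.congr_deriv (h1.trans ?_)
    change _ = -(4 * Real.pi * r p.1 ^ 2 * T p (Redshift.inclN p k) (Redshift.inclN p m) / r p.1)
    field_simp
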